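/- Let $n\ge 3$ and $K\ge 1$. For $\alpha\in\mathbb{R}$ let $R_s:\mathbb{R}^n\to\mathbb{R}^n$ be the radial stretch with spiraling, $R_s(0)=0$ and $$R_s(y)=\frac{K}{\sqrt{K^2+(1-K^2)\,y_1^2/|y|^2}}\,\bigl(y_1\cos\theta-y_2\sin\theta,\;y_1\sin\theta+y_2\cos\theta,\;y_3,\dots,y_n\bigr),\qquad \theta=\alpha\ln|y| .$$ For $x\in\mathbb{R}^n$ put $M(x)=\max\{|x_1|,\dots,|x_{n-1}|\}$ and $|x'|=\sqrt{x_1^2+\cdots+x_{n-1}^2}$. Let $\mathcal{Z}:\mathbb{R}^n\to\mathbb{R}^n\setminus\{0\}$ be the Zorich map, given on $[-\pi/2,\pi/2]^{n-1}\times\mathbb{R}$ by $$\mathcal{Z}(x)=e^{x_n}\Bigl(\tfrac{x_1\sin M(x)}{|x'|},\dots,\tfrac{x_{n-1}\sin M(x)}{|x'|},\cos M(x)\Bigr),\qquad \mathcal{Z}(0,\dots,0,x_n)=(0,\dots,0,e^{x_n}),$$ and extended to $\mathbb{R}^n$ by reflections in the faces $x_i\in\pi/2+\pi\mathbb{Z}$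 ($1\le i\le n-1$), each corresponding to the reflection $y_n\mapsto -y_n$ in the image. It maps the fundamental set $$B=\Bigl(\bigl[-\tfrac{\pi}{2},\tfrac{\pi}{2}\bigr]^{n-1}\cup\bigl(\tfrac{\pi}{2},\tfrac{3\pi}{2}\bigr)\times\bigl(-\tfrac{\pi}{2},\tfrac{\pi}{2}\bigr)^{n-2}\Bigr)\times\mathbb{R}$$ bijectively onto $\mathbb{R}^n\setminus\{0\}$. With $\mathcal{Z}^{-1}:\mathbb{R}^n\setminus\{0\}\to B$, the Zorich transform of $R_s$ is $\tilde R_s=\mathcal{Z}^{-1}\circ R_s\circ\mathcal{Z}$. A continuous map $f$ on a domain $U\subset\mathbb{R}^n$ is quasiregular if $f\in W^{1,n}_{\rm loc}(U)$ and there is $K'\ge1$ with $\|f'(x)\|^n\le K'J_f(x)$ for a.e. $x\in U$, where $f'$ is the weak derivative, $\|\cdot\|$ the operator norm and $J_f=\det f'$; it is quasiconformal if it is moreover injective. Then there are $\alpha_0>0$ and $C<\infty$, depending only on $n$ and $K$, such that for every $\alpha$ with $|\alpha|<\alpha_0$ the following hold. 1. $R_s$ is a homeomorphism of $\mathbb{R}^n$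 onto itself and is quasiconformal on $\mathbb{R}^n$. 2. $\tilde R_s$ is a bijection of $B$ onto $B$, $\mathcal{Z}\circ\tilde R_s=R_s\circ\mathcal{Z}$ on $B$, and on $[-\pi/2,\pi/2]^{n-1}\times\mathbb{R}$ one has $\tilde R_s(x)=(u_1,\dots,u_n)$ with $$u_i=M(x)\,m\,w_i\ (1\le i\le n-1),\qquad u_n=x_n+\ln K-\tfrac12\ln\Bigl(K^2+(1-K^2)\frac{x_1^2\sin^2M(x)}{|x'|^2}\Bigr),$$ where $w=(x_1\cos(\alpha x_n)-x_2\sin(\alpha x_n),\;x_1\sin(\alpha x_n)+x_2\cos(\alpha x_n),\;x_3,\dots,x_{n-1})$ and $m=\min_{1\le i\le n-1}1/|w_i|=1/\max_{1\le i\le n-1}|w_i|$ (for $x'=0$ this is read as $u=(0,\dots,0,x_n)$). Moreover $\tilde R_s$ is quasiconformal on each of the domains $(-\pi/2,\pi/2)^{n-1}\times\mathbb{R}$ and $(\pi/2,3\pi/2)\times(-\pi/2,\pi/2)^{n-2}\times\mathbb{R}$. 3. There is a closed set $E\subset\mathbb{R}^n$ with $\sigma$-finite $(n-1)$-dimensional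 Hausdorff measure such that at every $x\in B\setminus E$ the map $\tilde R_s$ is differentiable, $\|\tilde R_s'(x)\|\le C$ and $J_{\tilde R_s}(x)>2^{-(n+1)/2}$. -/

import Mathlib

open MeasureTheory
open scoped ContDiff

noncomputable section

/-! ### Quasiregular and quasiconformal maps -/

/-- `f` belongs to `L^p_loc(U)`. -/
def LocLp {X F : Type*} [TopologicalSpace X] [MeasureSpace X] [NormedAddCommGroup F]
    (p : ENNReal) (U : Set X) (f : X → F) : Prop :=
  ∀ S : Set X, IsCompact S → S ⊆ U → MemLp f p (volume.restrict S)

/-- `G` is a weak (distributional) derivative of `f` on `U`. -/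
def IsWeakDerivOn {n : ℕ} (U : Set (EuclideanSpace ℝ (Fin n)))
    (f : EuclideanSpace ℝ (Fin n) → EuclideanSpace ℝ (Fin n))
    (G : EuclideanSpace ℝ (Fin n) → EuclideanSpace ℝ (Fin n) →L[ℝ] EuclideanSpace ℝ (Fin n)) :
    Prop :=
  ∀ φ : EuclideanSpace ℝ (Fin n) → ℝ, ContDiff ℝ ∞ φ → HasCompactSupport φ → tsupport φ ⊆ U →
    ∀ v : EuclideanSpace ℝ (Fin n),
      ∫ x in U, (fderiv ℝ φ x v) • f x = - ∫ x in U, φ x • G x v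

/-- `f : U → ℝⁿ` is quasiregular on the domain `U`: it is continuous, lies in the Sobolev space
`W^{1,n}_loc(U)`, and its (weak) derivative satisfies `‖f'‖ⁿ ≤ K J_f` almost everywhere in `U`
for some `K ≥ 1`. -/
def IsQuasiregularOn {n : ℕ} (f : EuclideanSpace ℝ (Fin n) → EuclideanSpace ℝ (Fin n))
    (U : Set (EuclideanSpace ℝ (Fin n))) : Prop :=
  IsOpen U ∧ IsConnected U ∧ ContinuousOn f U ∧ LocLp n U f ∧
    ∃ G : EuclideanSpace ℝ (Fin n) → EuclideanSpace ℝ (Fin n) →L[ℝ] EuclideanSpace ℝ (Fin n),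
      LocLp n U G ∧ IsWeakDerivOn U f G ∧
        ∃ K : ℝ, 1 ≤ K ∧ ∀ᵐ x ∂(volume.restrict U), ‖G x‖ ^ n ≤ K * (G x).det

/-- A quasiconformal map is an injective quasiregular map. -/
def IsQuasiconformalOn {n : ℕ} (f : EuclideanSpace ℝ (Fin n) → EuclideanSpace ℝ (Fin n))
    (U : Set (EuclideanSpace ℝ (Fin n))) : Prop :=
  IsQuasiregularOn f U ∧ Set.InjOn f U

/-! ### The Zorich map and the Zorich transform (dimension `n ≥ 3`) -/

namespace Zorich

variable {n : ℕ}

/-- Index of the first coordinate. -/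
def idx₁ (hn : 3 ≤ n) : Fin n := ⟨0, by omega⟩

/-- Index of the second coordinate. -/
def idx₂ (hn : 3 ≤ n) : Fin n := ⟨1, by omega⟩

/-- Index of the last (`n`-th) coordinate. -/
def idxLast (hn : 3 ≤ n) : Fin n := ⟨n - 1, by omega⟩

/-- `M(x₁, …, x_{n-1}) = max {|x₁|, …, |x_{n-1}|}`. -/
def cubeNorm (hn : 3 ≤ n) (x : EuclideanSpace ℝ (Fin n)) : ℝ :=
  ⨆ i : {i : Fin n // i ≠ idxLast hn}, |x i|

/-- `√(x₁² + ⋯ + x_{n-1}²)`. -/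
def horizNorm (hn : 3 ≤ n) (x : EuclideanSpace ℝ (Fin n)) : ℝ :=
  √(∑ i ∈ Finset.univ.erase (idxLast hn), x i ^ 2)

/-- The map `(x₁, …, xₙ) ↦ e^{xₙ} g(x₁, …, x_{n-1})`, where `g` maps the cube `[-π/2, π/2]^{n-1}`
onto the closed upper unit hemisphere,
`g(x) = (x₁ sin M / |x'|, …, x_{n-1} sin M / |x'|, cos M)`, and `g(0) = (0, …, 0, 1)`. -/
def zorichBase (hn : 3 ≤ n) (x : EuclideanSpace ℝ (Fin n)) : EuclideanSpace ℝ (Fin n) :=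
  WithLp.toLp 2 fun i =>
    if i = idxLast hn then Real.exp (x (idxLast hn)) * Real.cos (cubeNorm hn x)
    else Real.exp (x (idxLast hn)) * (x i * Real.sin (cubeNorm hn x) / horizNorm hn x)

/-- The integer `k` such that `t` lies in the cell `[kπ - π/2, kπ + π/2)`. -/
def cellIndex (t : ℝ) : ℤ := round (t / Real.pi)

/-- The point of `[-π/2, π/2]` obtained from `t` by reflections in the points `π/2 + πℤ`. -/
def foldReal (t : ℝ) : ℝ := (-1 : ℝ) ^ cellIndex t * (t - cellIndex t * Real.pi)

/-- Move `x` to the cylinder `[-π/2, π/2]^{n-1} × ℝ` by reflections in the faces of the cubes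
`∏ [kᵢπ - π/2, kᵢπ + π/2]`. -/
def fold (hn : 3 ≤ n) (x : EuclideanSpace ℝ (Fin n)) : EuclideanSpace ℝ (Fin n) :=
  WithLp.toLp 2 fun i => if i = idxLast hn then x i else foldReal (x i)

/-- The parity (`1` or `-1`) of the number of reflections used in `fold`. -/
def foldSign (hn : 3 ≤ n) (x : EuclideanSpace ℝ (Fin n)) : ℝ :=
  ∏ i ∈ Finset.univ.erase (idxLast hn), (-1 : ℝ) ^ cellIndex (x i)

/-- The Zorich map on `ℝⁿ`: the extension of `zorichBase` by reflections, a reflection in a face of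
a cube corresponding to the reflection `yₙ ↦ -yₙ` in the image. -/
def zorichMap (hn : 3 ≤ n) (x : EuclideanSpace ℝ (Fin n)) : EuclideanSpace ℝ (Fin n) :=
  WithLp.toLp 2 fun i =>
    if i = idxLast hn then foldSign hn x * zorichBase hn (fold hn x) i
    else zorichBase hn (fold hn x) i

/-- The closed cylinder `[-π/2, π/2]^{n-1} × ℝ`. -/
def closedCell (hn : 3 ≤ n) : Set (EuclideanSpace ℝ (Fin n)) :=
  {x | ∀ i, i ≠ idxLast hn → |x i| ≤ Real.pi / 2}

/-- The open cylinder `(-π/2, π/2)^{n-1} × ℝ`. -/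
def openCell (hn : 3 ≤ n) : Set (EuclideanSpace ℝ (Fin n)) :=
  {x | ∀ i, i ≠ idxLast hn → |x i| < Real.pi / 2}

/-- The open cylinder `(π/2, 3π/2) × (-π/2, π/2)^{n-2} × ℝ`. -/
def openCell' (hn : 3 ≤ n) : Set (EuclideanSpace ℝ (Fin n)) :=
  {x | |x (idx₁ hn) - Real.pi| < Real.pi / 2 ∧
    ∀ i, i ≠ idxLast hn → i ≠ idx₁ hn → |x i| < Real.pi / 2}

/-- The fundamental set
`B = ([-π/2, π/2]^{n-1} ∪ (π/2, 3π/2) × (-π/2, π/2)^{n-2}) × ℝ` of the Zorich map. -/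
def fundamentalSet (hn : 3 ≤ n) : Set (EuclideanSpace ℝ (Fin n)) :=
  closedCell hn ∪ openCell' hn

/-- The Zorich transform `Z⁻¹ ∘ f ∘ Z`, where `Z⁻¹ : ℝⁿ \ {0} → B`. -/
def zorichTransform (hn : 3 ≤ n) (f : EuclideanSpace ℝ (Fin n) → EuclideanSpace ℝ (Fin n))
    (x : EuclideanSpace ℝ (Fin n)) : EuclideanSpace ℝ (Fin n) :=
  Function.invFunOn (zorichMap hn) (fundamentalSet hn) (f (zorichMap hn x))

/-! ### The radial stretch with spiraling -/

/-- Rotation by the angle `θ` in the plane of the first two coordinates. -/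
def planeRotation (hn : 3 ≤ n) (θ : ℝ) (y : EuclideanSpace ℝ (Fin n)) :
    EuclideanSpace ℝ (Fin n) :=
  WithLp.toLp 2 fun i =>
    if i = idx₁ hn then y (idx₁ hn) * Real.cos θ - y (idx₂ hn) * Real.sin θ
    else if i = idx₂ hn then y (idx₁ hn) * Real.sin θ + y (idx₂ hn) * Real.cos θ
    else y i

/-- The radial stretch with spiraling
`R_s(y) = K / √(K² + (1 - K²) y₁² / |y|²) • (rotation of y by the angle α ln |y|)`;
in particular `R_s(0) = 0`. -/
def spiralStretch (hn : 3 ≤ n) (K α : ℝ) (y : EuclideanSpace ℝ (Fin n)) :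
    EuclideanSpace ℝ (Fin n) :=
  (K / √(K ^ 2 + (1 - K ^ 2) * (y (idx₁ hn) ^ 2 / ‖y‖ ^ 2))) •
    planeRotation hn (α * Real.log ‖y‖) y

/-- The explicit formula for the Zorich transform of `R_s` on `[-π/2, π/2]^{n-1} × ℝ`. With
`w` the rotation of `x` by the angle `α xₙ`, the factor `m` (the minimum of the reciprocals
`1 / |wᵢ|`, `i < n`) is `1 / M(w)`. -/
def spiralFormula (hn : 3 ≤ n) (K α : ℝ) (x : EuclideanSpace ℝ (Fin n)) :
    EuclideanSpace ℝ (Fin n) :=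
  WithLp.toLp 2 fun i =>
    if i = idxLast hn then
      x i + Real.log K - 1 / 2 * Real.log (K ^ 2 + (1 - K ^ 2) *
        (x (idx₁ hn) ^ 2 * Real.sin (cubeNorm hn x) ^ 2 / horizNorm hn x ^ 2))
    else
      cubeNorm hn x * (1 / cubeNorm hn (planeRotation hn (α * x (idxLast hn)) x)) *
        planeRotation hn (α * x (idxLast hn)) x i

end Zorich

end

/-! In logarithmic polar coordinates y = e^t ν, the map R_s sends (t, ν) to (t + log c(ν₁), ν
rotated by αt), where 1 ≤ c ≤ K. The spiralling is thus a perturbation of size |α| of a plain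
stretch, and everything holds for small α with bounds depending only on n and K.

Global behaviour. If two points have the same image, their directions differ by at most 2|α||s - t|,
while equality of the radii gives |s - t| ≤ K³‖ν - η‖; for small α this forces equality
(`spiralStretch_injective`). Surjectivity is the intermediate value theorem in t. The map does not
decrease norms, hence is proper and a homeomorphism.

Quasiregularity comes from one criterion: a Lipschitz map on a domain whose Jacobian is a.e. bounded
below by a positive constant is quasiregular (`isQuasiregularOn_of_lipschitzOnWith`).

Jacobians. Freeze the rotation angle at the point considered. The frozen map is a rotation times a
factor constant along rays, whose derivative kills the radial vector, so
`LinearMap.det_eq_of_forall_apply` gives the exact determinant: cⁿ ≥ 1 for R_s, and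
(M(x)/M(w))^(n-1) for the transform. A plane rotation increases M by at most √2, so the latter is at
least 2^(-(n-1)/2), twice the required bound. Freezing changes the derivative by O(|α|), and the
determinant is uniformly continuous on bounded sets of operators, so for small α less than half is
lost (`exists_det_spiralStretch`, `exists_det_spiralFormula`).

The transform. The Zorich map is a bijection from B onto the punctured space (`zorichMap_bijOn`), so
it suffices to check that the explicit formula solves the conjugacy equation
(`zorichBase_spiralFormula`). The second cell follows by reflection. The formula can fail to be
smooth only where M has ties, at x or at w; these ties, their mirror images and the faces form the
closed exceptional set, covered by countably many hyperplane pieces and C¹ images of such pieces. -/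

noncomputable section

/-! ### Coordinates: the horizontal part and the cube norm. -/

namespace Zorich
variable {n : ℕ}

lemma idx₁_ne_idxLast (hn : 3 ≤ n) : idx₁ hn ≠ idxLast hn := by
  simp only [idx₁, idxLast, ne_eq, Fin.mk.injEq]; omega

lemma idx₂_ne_idxLast (hn : 3 ≤ n) : idx₂ hn ≠ idxLast hn := by
  simp only [idx₂, idxLast, ne_eq, Fin.mk.injEq]; omega

lemma idx₁_ne_idx₂ (hn : 3 ≤ n) : idx₁ hn ≠ idx₂ hn := by
  simp [idx₁, idx₂]

/-- The unit vector of the last coordinate axis. -/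
def axis (hn : 3 ≤ n) : EuclideanSpace ℝ (Fin n) := EuclideanSpace.single (idxLast hn) 1

/-- The projection that replaces the last coordinate by `0`. -/
def horiz (hn : 3 ≤ n) : EuclideanSpace ℝ (Fin n) →L[ℝ] EuclideanSpace ℝ (Fin n) :=
  ContinuousLinearMap.id ℝ _ -
    (EuclideanSpace.proj (𝕜 := ℝ) (idxLast hn)).smulRight (axis hn)

lemma horiz_eq (hn : 3 ≤ n) (x : EuclideanSpace ℝ (Fin n)) :
    horiz hn x = x - x (idxLast hn) • axis hn := by
  simp [horiz]

@[simp] lemma horiz_last (hn : 3 ≤ n) (x : EuclideanSpace ℝ (Fin n)) :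
    horiz hn x (idxLast hn) = 0 := by
  simp [horiz_eq, axis]

lemma horiz_apply (hn : 3 ≤ n) (x : EuclideanSpace ℝ (Fin n)) {i : Fin n}
    (hi : i ≠ idxLast hn) : horiz hn x i = x i := by
  simp [horiz_eq, axis, hi]

lemma horizNorm_eq_norm (hn : 3 ≤ n) (x : EuclideanSpace ℝ (Fin n)) :
    horizNorm hn x = ‖horiz hn x‖ := by
  rw [EuclideanSpace.norm_eq, horizNorm, ← Finset.add_sum_erase _ _ (Finset.mem_univ (idxLast hn))]
  simp only [horiz_last, norm_zero, ne_eq, OfNat.ofNat_ne_zero, not_false_eq_true, zero_pow,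
    zero_add, Real.norm_eq_abs, sq_abs]
  congr 1
  refine Finset.sum_congr rfl fun i hi => ?_
  rw [horiz_apply hn x (Finset.ne_of_mem_erase hi)]

lemma norm_sq_eq_horiz (hn : 3 ≤ n) (x : EuclideanSpace ℝ (Fin n)) :
    ‖x‖ ^ 2 = ‖horiz hn x‖ ^ 2 + x (idxLast hn) ^ 2 := by
  rw [← horizNorm_eq_norm, horizNorm, Real.sq_sqrt (Finset.sum_nonneg fun i _ => sq_nonneg _),
    EuclideanSpace.norm_sq_eq, ← Finset.add_sum_erase _ _ (Finset.mem_univ (idxLast hn))]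
  simp [add_comm]

lemma norm_horiz_le (hn : 3 ≤ n) (x : EuclideanSpace ℝ (Fin n)) : ‖horiz hn x‖ ≤ ‖x‖ := by
  refine abs_le_of_sq_le_sq' ?_ (norm_nonneg _) |>.2
  rw [norm_sq_eq_horiz hn x]; nlinarith [sq_nonneg (x (idxLast hn))]

lemma abs_apply_le_norm (x : EuclideanSpace ℝ (Fin n)) (i : Fin n) : |x i| ≤ ‖x‖ := by
  simpa using PiLp.norm_apply_le x i

instance nonempty_horizontal (hn : 3 ≤ n) : Nonempty {i : Fin n // i ≠ idxLast hn} :=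
  ⟨⟨idx₁ hn, idx₁_ne_idxLast hn⟩⟩

lemma abs_le_cubeNorm (hn : 3 ≤ n) (x : EuclideanSpace ℝ (Fin n)) {i : Fin n}
    (hi : i ≠ idxLast hn) : |x i| ≤ cubeNorm hn x :=
  le_ciSup (f := fun i : {i : Fin n // i ≠ idxLast hn} => |x i|)
    (Set.finite_range _).bddAbove ⟨i, hi⟩

lemma cubeNorm_le_iff (hn : 3 ≤ n) {x : EuclideanSpace ℝ (Fin n)} {a : ℝ} :
    cubeNorm hn x ≤ a ↔ ∀ i, i ≠ idxLast hn → |x i| ≤ a :=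
  ⟨fun h _ hi => (abs_le_cubeNorm hn x hi).trans h, fun h => ciSup_le fun i => h i i.2⟩

lemma exists_abs_eq_cubeNorm (hn : 3 ≤ n) (x : EuclideanSpace ℝ (Fin n)) :
    ∃ i, i ≠ idxLast hn ∧ |x i| = cubeNorm hn x := by
  obtain ⟨i, hi⟩ := exists_eq_ciSup_of_finite (f := fun i : {i : Fin n // i ≠ idxLast hn} => |x i|)
  exact ⟨i, i.2, hi⟩

lemma cubeNorm_nonneg (hn : 3 ≤ n) (x : EuclideanSpace ℝ (Fin n)) : 0 ≤ cubeNorm hn x :=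
  (abs_nonneg _).trans (abs_le_cubeNorm hn x (idx₁_ne_idxLast hn))

lemma cubeNorm_congr (hn : 3 ≤ n) {x y : EuclideanSpace ℝ (Fin n)}
    (h : ∀ i, i ≠ idxLast hn → |x i| = |y i|) : cubeNorm hn x = cubeNorm hn y :=
  iSup_congr fun i => h i i.2

lemma cubeNorm_smul (hn : 3 ≤ n) (c : ℝ) (x : EuclideanSpace ℝ (Fin n)) :
    cubeNorm hn (c • x) = |c| * cubeNorm hn x := by
  simp only [cubeNorm, PiLp.smul_apply, smul_eq_mul, abs_mul]
  exact (Real.mul_iSup_of_nonneg (abs_nonneg c) _).symm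

lemma cubeNorm_horiz (hn : 3 ≤ n) (x : EuclideanSpace ℝ (Fin n)) :
    cubeNorm hn (horiz hn x) = cubeNorm hn x :=
  cubeNorm_congr hn fun i hi => by rw [horiz_apply hn x hi]

lemma cubeNorm_le_norm_horiz (hn : 3 ≤ n) (x : EuclideanSpace ℝ (Fin n)) :
    cubeNorm hn x ≤ ‖horiz hn x‖ := by
  rw [cubeNorm_le_iff]
  intro i hi
  rw [← horiz_apply hn x hi]
  exact abs_apply_le_norm _ _

lemma abs_cubeNorm_sub_le (hn : 3 ≤ n) (x y : EuclideanSpace ℝ (Fin n)) :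
    |cubeNorm hn x - cubeNorm hn y| ≤ ‖horiz hn x - horiz hn y‖ := by
  have key : ∀ x y : EuclideanSpace ℝ (Fin n),
      cubeNorm hn x - cubeNorm hn y ≤ ‖horiz hn x - horiz hn y‖ := by
    intro x y
    rw [sub_le_iff_le_add, cubeNorm_le_iff]
    intro i hi
    have h1 := abs_apply_le_norm (horiz hn x - horiz hn y) i
    rw [PiLp.sub_apply, horiz_apply hn x hi, horiz_apply hn y hi] at h1
    have h2 := abs_le_cubeNorm hn y hi
    have h3 := abs_sub_abs_le_abs_sub (x i) (y i)
    linarith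
  rw [abs_le]
  have := key y x
  rw [norm_sub_rev] at this
  exact ⟨by linarith, key x y⟩

lemma norm_horiz_le_mul_cubeNorm (hn : 3 ≤ n) (x : EuclideanSpace ℝ (Fin n)) :
    ‖horiz hn x‖ ≤ n * cubeNorm hn x := by
  have h0 := cubeNorm_nonneg hn x
  refine abs_le_of_sq_le_sq' ?_ (by positivity) |>.2
  rw [EuclideanSpace.norm_sq_eq]
  calc ∑ i, ‖horiz hn x i‖ ^ 2 ≤ ∑ _i : Fin n, cubeNorm hn x ^ 2 := by
        refine Finset.sum_le_sum fun i _ => ?_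
        rw [Real.norm_eq_abs]
        by_cases hi : i = idxLast hn
        · subst hi; simpa using sq_nonneg _
        · rw [horiz_apply hn x hi]
          exact pow_le_pow_left₀ (abs_nonneg _) (abs_le_cubeNorm hn x hi) 2
    _ = n * cubeNorm hn x ^ 2 := by simp
    _ ≤ (n * cubeNorm hn x) ^ 2 := by
        have : (1 : ℝ) ≤ n := by exact_mod_cast (by omega : 1 ≤ n)
        rw [mul_pow]
        nlinarith [mul_nonneg (sub_nonneg.2 this)
          (mul_nonneg (Nat.cast_nonneg (α := ℝ) n) (sq_nonneg (cubeNorm hn x)))]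

lemma cubeNorm_eq_zero_iff (hn : 3 ≤ n) (x : EuclideanSpace ℝ (Fin n)) :
    cubeNorm hn x = 0 ↔ horiz hn x = 0 := by
  refine ⟨fun h => ?_, fun h => ?_⟩
  · have := norm_horiz_le_mul_cubeNorm hn x
    rw [h, mul_zero] at this
    exact norm_le_zero_iff.1 this
  · have := cubeNorm_le_norm_horiz hn x
    rw [h, norm_zero] at this
    exact le_antisymm this (cubeNorm_nonneg hn x)

/-! ### Rotations -/

/-- `planeRotation` as a linear map. -/
def rotationL (hn : 3 ≤ n) (θ : ℝ) : EuclideanSpace ℝ (Fin n) →ₗ[ℝ] EuclideanSpace ℝ (Fin n) where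
  toFun := planeRotation hn θ
  map_add' x y := by
    ext i
    simp only [planeRotation, PiLp.add_apply]
    split_ifs <;> ring
  map_smul' c x := by
    ext i
    simp only [planeRotation, PiLp.smul_apply, smul_eq_mul, RingHom.id_apply]
    split_ifs <;> ring

lemma rotationL_apply (hn : 3 ≤ n) (θ : ℝ) (x : EuclideanSpace ℝ (Fin n)) :
    rotationL hn θ x = planeRotation hn θ x := rfl

lemma planeRotation_sub (hn : 3 ≤ n) (θ : ℝ) (x y : EuclideanSpace ℝ (Fin n)) :
    planeRotation hn θ (x - y) = planeRotation hn θ x - planeRotation hn θ y :=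
  (rotationL hn θ).map_sub x y

lemma planeRotation_add (hn : 3 ≤ n) (θ : ℝ) (x y : EuclideanSpace ℝ (Fin n)) :
    planeRotation hn θ (x + y) = planeRotation hn θ x + planeRotation hn θ y :=
  (rotationL hn θ).map_add x y

lemma planeRotation_smul (hn : 3 ≤ n) (θ c : ℝ) (x : EuclideanSpace ℝ (Fin n)) :
    planeRotation hn θ (c • x) = c • planeRotation hn θ x :=
  (rotationL hn θ).map_smul c x

lemma planeRotation_zero_right (hn : 3 ≤ n) (θ : ℝ) :
    planeRotation hn θ (0 : EuclideanSpace ℝ (Fin n)) = 0 :=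
  (rotationL hn θ).map_zero

lemma planeRotation_idx₁ (hn : 3 ≤ n) (θ : ℝ) (x : EuclideanSpace ℝ (Fin n)) :
    planeRotation hn θ x (idx₁ hn) =
      x (idx₁ hn) * Real.cos θ - x (idx₂ hn) * Real.sin θ := by
  simp [planeRotation]

lemma planeRotation_idx₂ (hn : 3 ≤ n) (θ : ℝ) (x : EuclideanSpace ℝ (Fin n)) :
    planeRotation hn θ x (idx₂ hn) =
      x (idx₁ hn) * Real.sin θ + x (idx₂ hn) * Real.cos θ := by
  simp [planeRotation, (idx₁_ne_idx₂ hn).symm]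

lemma planeRotation_of_ne (hn : 3 ≤ n) (θ : ℝ) (x : EuclideanSpace ℝ (Fin n)) {i : Fin n}
    (h₁ : i ≠ idx₁ hn) (h₂ : i ≠ idx₂ hn) : planeRotation hn θ x i = x i := by
  simp [planeRotation, h₁, h₂]

@[simp] lemma planeRotation_last (hn : 3 ≤ n) (θ : ℝ) (x : EuclideanSpace ℝ (Fin n)) :
    planeRotation hn θ x (idxLast hn) = x (idxLast hn) :=
  planeRotation_of_ne hn θ x (idx₁_ne_idxLast hn).symm (idx₂_ne_idxLast hn).symm

lemma ext_idx (hn : 3 ≤ n) {x y : EuclideanSpace ℝ (Fin n)} (h₁ : x (idx₁ hn) = y (idx₁ hn))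
    (h₂ : x (idx₂ hn) = y (idx₂ hn)) (h : ∀ i, i ≠ idx₁ hn → i ≠ idx₂ hn → x i = y i) :
    x = y := by
  ext i
  by_cases hi : i = idx₁ hn
  · rw [hi, h₁]
  by_cases hi' : i = idx₂ hn
  · rw [hi', h₂]
  exact h i hi hi'

lemma planeRotation_planeRotation (hn : 3 ≤ n) (θ φ : ℝ) (x : EuclideanSpace ℝ (Fin n)) :
    planeRotation hn θ (planeRotation hn φ x) = planeRotation hn (θ + φ) x := by
  refine ext_idx hn ?_ ?_ fun i h₁ h₂ => ?_
  · simp only [planeRotation_idx₁, planeRotation_idx₂, Real.cos_add, Real.sin_add]; ring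
  · simp only [planeRotation_idx₁, planeRotation_idx₂, Real.cos_add, Real.sin_add]; ring
  · simp only [planeRotation_of_ne hn _ _ h₁ h₂]

@[simp] lemma planeRotation_zero (hn : 3 ≤ n) (x : EuclideanSpace ℝ (Fin n)) :
    planeRotation hn 0 x = x := by
  refine ext_idx hn ?_ ?_ fun i h₁ h₂ => ?_
  · simp [planeRotation_idx₁]
  · simp [planeRotation_idx₂]
  · simp only [planeRotation_of_ne hn _ _ h₁ h₂]

lemma planeRotation_axis (hn : 3 ≤ n) (θ : ℝ) : planeRotation hn θ (axis hn) = axis hn := by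
  refine ext_idx hn ?_ ?_ fun i h₁ h₂ => ?_
  · simp [planeRotation_idx₁, axis, idx₁_ne_idxLast, idx₂_ne_idxLast]
  · simp [planeRotation_idx₂, axis, idx₁_ne_idxLast, idx₂_ne_idxLast]
  · simp only [planeRotation_of_ne hn _ _ h₁ h₂]

lemma horiz_planeRotation (hn : 3 ≤ n) (θ : ℝ) (x : EuclideanSpace ℝ (Fin n)) :
    horiz hn (planeRotation hn θ x) = planeRotation hn θ (horiz hn x) := by
  rw [horiz_eq, horiz_eq, planeRotation_sub, planeRotation_smul, planeRotation_axis,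
    planeRotation_last]

lemma norm_sq_eq_idx (hn : 3 ≤ n) (x : EuclideanSpace ℝ (Fin n)) :
    ‖x‖ ^ 2 = x (idx₁ hn) ^ 2 + x (idx₂ hn) ^ 2 +
      ∑ i ∈ (Finset.univ.erase (idx₁ hn)).erase (idx₂ hn), x i ^ 2 := by
  rw [EuclideanSpace.norm_sq_eq, ← Finset.add_sum_erase _ _ (Finset.mem_univ (idx₁ hn)),
    ← Finset.add_sum_erase _ _
      (Finset.mem_erase.2 ⟨(idx₁_ne_idx₂ hn).symm, Finset.mem_univ (idx₂ hn)⟩)]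
  simp [add_assoc]

@[simp] lemma norm_planeRotation (hn : 3 ≤ n) (θ : ℝ) (x : EuclideanSpace ℝ (Fin n)) :
    ‖planeRotation hn θ x‖ = ‖x‖ := by
  rw [← sq_eq_sq₀ (norm_nonneg _) (norm_nonneg _), norm_sq_eq_idx hn, norm_sq_eq_idx hn x]
  congr 1
  · rw [planeRotation_idx₁, planeRotation_idx₂]
    linear_combination (x (idx₁ hn) ^ 2 + x (idx₂ hn) ^ 2) * Real.sin_sq_add_cos_sq θ
  · refine Finset.sum_congr rfl fun i hi => ?_
    simp only [Finset.mem_erase] at hi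
    rw [planeRotation_of_ne hn _ _ hi.2.1 hi.1]

lemma norm_planeRotation_sub_le (hn : 3 ≤ n) (θ φ : ℝ) (x : EuclideanSpace ℝ (Fin n)) :
    ‖planeRotation hn θ x - planeRotation hn φ x‖ ≤ 2 * |θ - φ| * ‖x‖ := by
  refine abs_le_of_sq_le_sq' ?_ (by positivity) |>.2
  have hc : |Real.cos θ - Real.cos φ| ≤ |θ - φ| := Real.abs_cos_sub_cos_le θ φ
  have hs : |Real.sin θ - Real.sin φ| ≤ |θ - φ| := Real.abs_sin_sub_sin_le θ φ
  have hc' := pow_le_pow_left₀ (abs_nonneg _) hc 2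
  have hs' := pow_le_pow_left₀ (abs_nonneg _) hs 2
  rw [sq_abs, sq_abs] at hc' hs'
  have hx : x (idx₁ hn) ^ 2 + x (idx₂ hn) ^ 2 ≤ ‖x‖ ^ 2 := by
    rw [norm_sq_eq_idx hn x]
    have := Finset.sum_nonneg (s := (Finset.univ.erase (idx₁ hn)).erase (idx₂ hn))
      (f := fun i => x i ^ 2) fun i _ => sq_nonneg (x i)
    linarith
  rw [norm_sq_eq_idx hn]
  have h0 : ∑ i ∈ (Finset.univ.erase (idx₁ hn)).erase (idx₂ hn),
      (planeRotation hn θ x - planeRotation hn φ x) i ^ 2 = 0 := by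
    refine Finset.sum_eq_zero fun i hi => ?_
    simp only [Finset.mem_erase] at hi
    simp [planeRotation_of_ne hn _ _ hi.2.1 hi.1]
  rw [h0, PiLp.sub_apply, PiLp.sub_apply, planeRotation_idx₁, planeRotation_idx₂,
    planeRotation_idx₁, planeRotation_idx₂, mul_pow, mul_pow, sq_abs]
  nlinarith [mul_le_mul hx hc' (sq_nonneg _) (sq_nonneg _),
    mul_le_mul hx hs' (sq_nonneg _) (sq_nonneg _), mul_nonneg (sq_nonneg ‖x‖) (sq_nonneg (θ - φ))]

/-- No matrix is expanded. The determinant is multiplicative in the angle, and conjugation by a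
reflection S shows that it is even, so its square is 1; halving the angle writes the determinant
itself as such a square. -/
lemma det_rotationL (hn : 3 ≤ n) (θ : ℝ) : LinearMap.det (rotationL hn θ) = 1 := by
  have hadd : ∀ s t : ℝ, LinearMap.det (rotationL hn s) * LinearMap.det (rotationL hn t) =
      LinearMap.det (rotationL hn (s + t)) := by
    intro s t
    rw [← LinearMap.det_comp]
    congr 1
    ext x : 1
    exact planeRotation_planeRotation hn s t x
  have hzero : LinearMap.det (rotationL hn 0) = 1 := by
    rw [← LinearMap.det_id (A := ℝ) (M := EuclideanSpace ℝ (Fin n))]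
    congr 1
    ext x : 1
    exact planeRotation_zero hn x
  let S : EuclideanSpace ℝ (Fin n) →ₗ[ℝ] EuclideanSpace ℝ (Fin n) :=
    { toFun := fun x => WithLp.toLp 2 fun i => if i = idx₂ hn then - x i else x i
      map_add' := fun x y => by
        ext i; simp only [PiLp.add_apply]; split_ifs <;> ring
      map_smul' := fun c x => by
        ext i; simp only [PiLp.smul_apply, smul_eq_mul, RingHom.id_apply]; split_ifs <;> ring }
  have hS : LinearMap.det S * LinearMap.det S = 1 := by
    rw [← LinearMap.det_comp, ← LinearMap.det_id (A := ℝ) (M := EuclideanSpace ℝ (Fin n))]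
    congr 1
    ext x i
    simp only [S, LinearMap.coe_comp, LinearMap.coe_mk, AddHom.coe_mk, Function.comp_apply,
      LinearMap.id_coe, id_eq]
    split_ifs <;> simp
  have hneg : ∀ t, LinearMap.det (rotationL hn (-t)) = LinearMap.det (rotationL hn t) := by
    intro t
    have : rotationL hn (-t) = S ∘ₗ rotationL hn t ∘ₗ S := by
      refine LinearMap.ext fun x => ext_idx hn ?_ ?_ fun i h₁ h₂ => ?_
      · simp [S, rotationL_apply, planeRotation_idx₁, idx₁_ne_idx₂ hn]
      · simp [S, rotationL_apply, planeRotation_idx₂, idx₁_ne_idx₂ hn]; ring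
      · simp [S, rotationL_apply, planeRotation_of_ne hn _ _ h₁ h₂, h₂]
    rw [this, LinearMap.det_comp, LinearMap.det_comp]
    linear_combination (LinearMap.det (rotationL hn t)) * hS
  have h1 := hadd (θ / 2) (θ / 2)
  have h2 := hadd (-(θ / 2)) (θ / 2)
  rw [hneg, neg_add_cancel, hzero] at h2
  rw [add_halves] at h1
  rw [← h1, h2]

/-- Only two coordinates are mixed, and their Euclidean length, at most √2 M(x), is preserved. This
√2 is the source of the power of 2 in the Jacobian bound. -/
lemma cubeNorm_planeRotation_le (hn : 3 ≤ n) (θ : ℝ) (x : EuclideanSpace ℝ (Fin n)) :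
    cubeNorm hn (planeRotation hn θ x) ≤ √2 * cubeNorm hn x := by
  have h0 := cubeNorm_nonneg hn x
  have h1 := pow_le_pow_left₀ (abs_nonneg _) (abs_le_cubeNorm hn x (idx₁_ne_idxLast hn)) 2
  have h2 := pow_le_pow_left₀ (abs_nonneg _) (abs_le_cubeNorm hn x (idx₂_ne_idxLast hn)) 2
  rw [sq_abs] at h1 h2
  have hcs := Real.sin_sq_add_cos_sq θ
  have hr : planeRotation hn θ x (idx₁ hn) ^ 2 + planeRotation hn θ x (idx₂ hn) ^ 2 =
      x (idx₁ hn) ^ 2 + x (idx₂ hn) ^ 2 := by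
    rw [planeRotation_idx₁, planeRotation_idx₂]
    linear_combination (x (idx₁ hn) ^ 2 + x (idx₂ hn) ^ 2) * hcs
  have hsq : (√2 * cubeNorm hn x) ^ 2 = 2 * cubeNorm hn x ^ 2 := by
    rw [mul_pow, Real.sq_sqrt (by norm_num)]
  rw [cubeNorm_le_iff]
  intro i hi
  by_cases hi₁ : i = idx₁ hn
  · subst hi₁
    refine abs_le_of_sq_le_sq ?_ (by positivity)
    rw [hsq]; nlinarith [sq_nonneg (planeRotation hn θ x (idx₂ hn))]
  by_cases hi₂ : i = idx₂ hn
  · subst hi₂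
    refine abs_le_of_sq_le_sq ?_ (by positivity)
    rw [hsq]; nlinarith [sq_nonneg (planeRotation hn θ x (idx₁ hn))]
  · rw [planeRotation_of_ne hn _ _ hi₁ hi₂]
    have := abs_le_cubeNorm hn x hi
    have h3 : (1 : ℝ) ≤ √2 := by rw [Real.one_le_sqrt]; norm_num
    nlinarith

lemma cubeNorm_le_planeRotation (hn : 3 ≤ n) (θ : ℝ) (x : EuclideanSpace ℝ (Fin n)) :
    cubeNorm hn x ≤ √2 * cubeNorm hn (planeRotation hn θ x) := by
  have := cubeNorm_planeRotation_le hn (-θ) (planeRotation hn θ x)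
  rwa [planeRotation_planeRotation, neg_add_cancel, planeRotation_zero] at this

/-- Stability of a vector rescaled to prescribed size: if `a`, `b` are the sizes and `p`, `q`
normalize `u`, `v`. -/
lemma norm_rescale_sub_le {V : Type*} [NormedAddCommGroup V] [NormedSpace ℝ V] {u v : V}
    {a b p q A D : ℝ} (hp : 0 ≤ p) (hq : 0 ≤ q) (hu : ‖u‖ ≤ D * p) (hv : ‖v‖ ≤ D * q)
    (ha : |a| ≤ A * p) (hb : |b| ≤ A * q) (hA : 0 ≤ A) (hD : 0 ≤ D) :
    ‖(a / p) • u - (b / q) • v‖ ≤ D * |a - b| + A * (‖u - v‖ + D * |p - q|) := by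
  -- If a normalizer vanishes, the size bound forces the corresponding size to vanish as well, so
  -- the convention a / 0 = 0 gives the right value and the estimate survives at the singular point.
  rcases hp.eq_or_lt with rfl | hp
  · have ha0 : a = 0 := by simpa using ha
    rcases hq.eq_or_lt with rfl | hq
    · simp only [div_zero, zero_smul, sub_zero, norm_zero]; positivity
    · subst ha0
      simp only [div_zero, zero_smul, zero_sub, norm_neg, norm_smul, norm_div, Real.norm_eq_abs,
        abs_neg, abs_of_pos hq]
      have : |b| / q * ‖v‖ ≤ D * |b| := by
        rw [div_mul_eq_mul_div, div_le_iff₀ hq]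
        nlinarith [abs_nonneg b]
      nlinarith [norm_nonneg (u - v), mul_nonneg hA (norm_nonneg (u - v)),
        mul_nonneg hA (mul_nonneg hD hq.le)]
  rcases hq.eq_or_lt with rfl | hq
  · have hb0 : b = 0 := by simpa using hb
    subst hb0
    simp only [div_zero, zero_smul, sub_zero, norm_smul, norm_div, Real.norm_eq_abs, abs_of_pos hp]
    have : |a| / p * ‖u‖ ≤ D * |a| := by
      rw [div_mul_eq_mul_div, div_le_iff₀ hp]
      nlinarith [abs_nonneg a]
    nlinarith [norm_nonneg (u - v), mul_nonneg hA (norm_nonneg (u - v)),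
      mul_nonneg hA (mul_nonneg hD hp.le)]
  -- Change the size first, then the vector, then the normalizer; each term is controlled by ‖v‖ / q
  -- ≤ D and |a| / p ≤ A.
  have key : (a / p) • u - (b / q) • v =
      ((a - b) / q) • v + (a / p) • ((u - v) + ((q - p) / q) • v) := by
    have e : (a - b) / q + a / p * (-1 + (q - p) / q) = - (b / q) := by field_simp; ring
    calc (a / p) • u - (b / q) • v = (a / p) • u + (- (b / q)) • v := by module
      _ = _ := by rw [← e]; module
  have hvq : ‖v‖ / q ≤ D := by rwa [div_le_iff₀ hq]
  have hap : |a| / p ≤ A := by rwa [div_le_iff₀ hp]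
  rw [key]
  refine (norm_add_le _ _).trans (add_le_add ?_ ?_)
  · rw [norm_smul, norm_div, Real.norm_eq_abs, Real.norm_eq_abs, abs_of_pos hq]
    calc |a - b| / q * ‖v‖ = ‖v‖ / q * |a - b| := by ring
      _ ≤ _ := by gcongr
  · rw [norm_smul, norm_div, Real.norm_eq_abs, Real.norm_eq_abs, abs_of_pos hp]
    refine mul_le_mul hap ((norm_add_le _ _).trans (add_le_add le_rfl ?_)) (norm_nonneg _) hA
    rw [norm_smul, norm_div, Real.norm_eq_abs, Real.norm_eq_abs, abs_of_pos hq]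
    calc |q - p| / q * ‖v‖ = ‖v‖ / q * |p - q| := by rw [abs_sub_comm]; ring
      _ ≤ _ := by gcongr

end Zorich

/-! ### Weak derivatives and quasiregularity of Lipschitz maps. -/

open Filter Topology in
/-- The integration by parts formula for a Lipschitz map and a smooth compactly supported
function. -/
lemma LipschitzWith.isWeakDerivOn_fderiv {n : ℕ} {L : NNReal}
    {f : EuclideanSpace ℝ (Fin n) → EuclideanSpace ℝ (Fin n)} (hf : LipschitzWith L f)
    (U : Set (EuclideanSpace ℝ (Fin n))) : IsWeakDerivOn U f (fderiv ℝ f) := by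
  intro φ hφ hφc hφU v
  obtain ⟨D, hD⟩ := hφ.lipschitzWith_of_hasCompactSupport hφc (by simp)
  have hφ0 : ∀ x, x ∉ U → φ x = 0 := fun x hx => by
    by_contra h
    exact hx (hφU (subset_tsupport φ h))
  have hφ'0 : ∀ x, x ∉ U → fderiv ℝ φ x = 0 := fun x hx => by
    by_contra h
    exact hx (hφU (support_fderiv_subset ℝ h))
  rw [setIntegral_eq_integral_of_forall_compl_eq_zero fun x hx => by simp [hφ'0 x hx],
    setIntegral_eq_integral_of_forall_compl_eq_zero fun x hx => by simp [hφ0 x hx]]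
  have hφd : Continuous fun x => fderiv ℝ φ x v :=
    (hφ.continuous_fderiv (by simp)).clm_apply continuous_const
  have hφdc : HasCompactSupport fun x => fderiv ℝ φ x v := hφc.fderiv_apply ℝ v
  have hint1 : Integrable fun x => (fderiv ℝ φ x v) • f x :=
    (hφd.smul hf.continuous).integrable_of_hasCompactSupport hφdc.smul_right
  have hint2 : Integrable fun x => φ x • fderiv ℝ f x v := by
    have hφi : Integrable φ := hφ.continuous.integrable_of_hasCompactSupport hφc
    refine (hφi.norm.mul_const (L * ‖v‖)).mono'
      (hφ.continuous.aestronglyMeasurable.smul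
        (measurable_fderiv_apply_const ℝ f v).aestronglyMeasurable) ?_
    refine Eventually.of_forall fun x => ?_
    rw [norm_smul]
    gcongr
    exact ContinuousLinearMap.le_of_opNorm_le _ (norm_fderiv_le_of_lipschitz ℝ hf) v
  -- Integration by parts against a Lipschitz function is a scalar statement, so it is applied to
  -- each coordinate; Rademacher's theorem then identifies the line derivative with the Fréchet
  -- derivative a.e.
  ext i
  have e1 : (∫ x, (fderiv ℝ φ x v) • f x) i = ∫ x, fderiv ℝ φ x v * f x i := by
    have := (EuclideanSpace.proj (𝕜 := ℝ) i).integral_comp_comm hint1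
    simpa using this.symm
  have e2 : (∫ x, φ x • fderiv ℝ f x v) i = ∫ x, φ x * fderiv ℝ f x v i := by
    have := (EuclideanSpace.proj (𝕜 := ℝ) i).integral_comp_comm hint2
    simpa using this.symm
  rw [PiLp.neg_apply, e1, e2]
  have hfi : LipschitzWith L fun x => f x i := by
    have h1 : LipschitzWith 1 fun y : EuclideanSpace ℝ (Fin n) => y i :=
      LipschitzWith.mk_one fun x y => by
        rw [Real.dist_eq, dist_eq_norm]
        simpa using PiLp.norm_apply_le (x - y) i
    have := h1.comp hf
    rwa [one_mul] at this
  have key := integral_lineDeriv_mul_eq (μ := volume) hfi hD hφc v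
  have hl : ∀ᵐ x : EuclideanSpace ℝ (Fin n), φ x * fderiv ℝ f x v i =
      lineDeriv ℝ (fun x => f x i) x v * φ x := by
    filter_upwards [hf.ae_differentiableAt] with x hx
    have h1 : HasFDerivAt (fun x => f x i)
        ((EuclideanSpace.proj (𝕜 := ℝ) i).comp (fderiv ℝ f x)) x :=
      (EuclideanSpace.proj (𝕜 := ℝ) i).hasFDerivAt.comp x hx.hasFDerivAt
    rw [(h1.hasLineDerivAt v).lineDeriv]
    simp [mul_comm]
  rw [integral_congr_ae hl, key, ← integral_neg]
  refine integral_congr_ae (Eventually.of_forall fun x => ?_)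
  have h1 := (hφ.differentiable (by simp)) x
  simp [h1.lineDeriv_eq_fderiv]

lemma MeasureTheory.locLp_of_continuousOn {X F : Type*} [TopologicalSpace X] [T2Space X]
    [MeasureSpace X] [OpensMeasurableSpace X] [IsFiniteMeasureOnCompacts (volume : Measure X)]
    [NormedAddCommGroup F] [SecondCountableTopology F] {p : ENNReal}
    {U : Set X} {f : X → F} (hf : ContinuousOn f U) : LocLp p U f := by
  intro S hS hSU
  have hc := hf.mono hSU
  obtain ⟨C, hC⟩ := hS.exists_bound_of_continuousOn hc
  have : IsFiniteMeasure (volume.restrict S) := isFiniteMeasure_restrict.2 hS.measure_ne_top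
  borelize F
  refine MemLp.of_bound (hc.aestronglyMeasurable hS.measurableSet) C ?_
  exact (ae_restrict_iff' hS.measurableSet).2 (Filter.Eventually.of_forall hC)

/-- A Lipschitz map whose Jacobian determinant is bounded below by a positive constant is
quasiregular. -/
lemma isQuasiregularOn_of_lipschitzOnWith {n : ℕ} {L : NNReal} {c : ℝ}
    {f : EuclideanSpace ℝ (Fin n) → EuclideanSpace ℝ (Fin n)}
    {U : Set (EuclideanSpace ℝ (Fin n))} (hU : IsOpen U) (hconn : IsConnected U)
    (hf : LipschitzOnWith L f U) (hc : 0 < c)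
    (hdet : ∀ᵐ x ∂(volume.restrict U), c ≤ (fderiv ℝ f x).det) : IsQuasiregularOn f U := by
  refine ⟨hU, hconn, hf.continuousOn, locLp_of_continuousOn hf.continuousOn, ?_⟩
  -- A globally Lipschitz extension has a derivative bounded everywhere, which serves as the weak
  -- derivative; on the open set U it agrees with that of f.
  obtain ⟨F, hF, hfF⟩ := hf.extend_finite_dimension
  set L' : NNReal := lipschitzExtensionConstant (EuclideanSpace ℝ (Fin n)) * L
  have hbound : ∀ x, ‖fderiv ℝ F x‖ ≤ L' := fun x => norm_fderiv_le_of_lipschitz ℝ hF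
  refine ⟨fderiv ℝ F, ?_, ?_, max 1 ((L' : ℝ) ^ n / c), le_max_left _ _, ?_⟩
  · intro S hS _
    have : IsFiniteMeasure (volume.restrict S) := isFiniteMeasure_restrict.2 hS.measure_ne_top
    exact MemLp.of_bound (measurable_fderiv ℝ F).aestronglyMeasurable L'
      (Filter.Eventually.of_forall hbound)
  · intro φ hφ hφc hφU v
    rw [← hF.isWeakDerivOn_fderiv U φ hφ hφc hφU v]
    exact setIntegral_congr_fun hU.measurableSet fun x hx => by simp only [hfF hx]
  · filter_upwards [hdet, ae_restrict_mem hU.measurableSet] with x hx hxU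
    have : fderiv ℝ F x = fderiv ℝ f x :=
      (Filter.eventuallyEq_of_mem (hU.mem_nhds hxU) hfF).symm.fderiv_eq
    rw [← this] at hx
    have h1 : ‖fderiv ℝ F x‖ ^ n ≤ (L' : ℝ) ^ n := pow_le_pow_left₀ (norm_nonneg _) (hbound x) n
    calc ‖fderiv ℝ F x‖ ^ n ≤ (L' : ℝ) ^ n / c * c := by rwa [div_mul_cancel₀ _ hc.ne']
      _ ≤ max 1 ((L' : ℝ) ^ n / c) * (fderiv ℝ F x).det := by
        gcongr
        exact le_max_right _ _

/-! ### Determinants -/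

/-- Since a e = 0, the two rank-one corrections combine without cross term into a product of
transvections, with determinants 1 + a p = 1 and 1 + b e. In the applications p is the radial or
horizontal vector, along which a homogeneous factor has zero derivative. -/
lemma LinearMap.det_eq_of_forall_apply {V : Type*} [AddCommGroup V] [Module ℝ V]
    [FiniteDimensional ℝ V] {A ρ : V →ₗ[ℝ] V} {l : ℝ} {a b : Module.Dual ℝ V} {p e : V}
    (hA : ∀ v, A v = l • ρ (v + a v • p + b v • e)) (hρ : LinearMap.det ρ = 1)
    (hp : a p = 0) (he : a e = 0) :
    LinearMap.det A = l ^ Module.finrank ℝ V * (1 + b e) := by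
  have : A = l • (ρ ∘ₗ LinearMap.transvection a p ∘ₗ LinearMap.transvection b e) := by
    ext v
    simp only [LinearMap.smul_apply, LinearMap.comp_apply, LinearMap.transvection.apply, hA,
      map_add a, map_smul a, he, smul_eq_mul, mul_zero, add_zero]
    congr 2
    abel
  rw [this, LinearMap.det_smul, LinearMap.det_comp, LinearMap.det_comp, hρ,
    LinearMap.transvection.det, LinearMap.transvection.det, hp]
  ring

/-- The determinant is uniformly continuous on bounded sets of operators. -/
lemma ContinuousLinearMap.exists_forall_det_sub_lt {V : Type*} [NormedAddCommGroup V]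
    [NormedSpace ℝ V] [FiniteDimensional ℝ V] (R : ℝ) {ε : ℝ} (hε : 0 < ε) :
    ∃ δ > 0, ∀ A B : V →L[ℝ] V, ‖A‖ ≤ R → ‖B‖ ≤ R → ‖A - B‖ < δ → B.det - ε < A.det := by
  have : ProperSpace (V →L[ℝ] V) := FiniteDimensional.proper ℝ _
  have hu := (isCompact_closedBall (0 : V →L[ℝ] V) R).uniformContinuousOn_of_continuous
    (ContinuousLinearMap.continuous_det (𝕜 := ℝ) (E := V)).continuousOn
  rw [Metric.uniformContinuousOn_iff] at hu
  obtain ⟨δ, hδ, h⟩ := hu ε hε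
  refine ⟨δ, hδ, fun A B hA hB hAB => ?_⟩
  have := h A (by simpa using hA) B (by simpa using hB) (by rwa [dist_eq_norm])
  rw [Real.dist_eq, abs_lt] at this
  linarith [this.1]

open Filter Topology in
lemma fderiv_apply_eq_zero_of_eventually_eq {V W : Type*} [NormedAddCommGroup V]
    [NormedSpace ℝ V] [NormedAddCommGroup W] [NormedSpace ℝ W] {g : V → W} {x v : V}
    (hg : DifferentiableAt ℝ g x) (h : ∀ᶠ t : ℝ in 𝓝 0, g (x + t • v) = g x) :
    fderiv ℝ g x v = 0 := by
  rw [← hg.lineDeriv_eq_fderiv, lineDeriv]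
  have : (fun t : ℝ => g (x + t • v)) =ᶠ[𝓝 0] fun _ => g x := h
  rw [this.deriv_eq, deriv_const]

/-! ### The map R_s: Lipschitz bound, bijectivity, Jacobian. -/

namespace Zorich
variable {n : ℕ}

/-- The factor by which the radial stretch expands in directions with first coordinate `t`. -/
def stretchFactor (K t : ℝ) : ℝ := K / √(K ^ 2 + (1 - K ^ 2) * t ^ 2)

lemma one_le_stretch_radicand {K t : ℝ} (hK : 1 ≤ K) (ht : |t| ≤ 1) :
    1 ≤ K ^ 2 + (1 - K ^ 2) * t ^ 2 := by
  have h1 : t ^ 2 ≤ 1 := (sq_le_one_iff_abs_le_one t).2 ht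
  nlinarith [mul_nonneg (show 0 ≤ K ^ 2 - 1 by nlinarith) (sub_nonneg.2 h1)]

lemma one_le_stretchFactor {K t : ℝ} (hK : 1 ≤ K) (ht : |t| ≤ 1) : 1 ≤ stretchFactor K t := by
  have h := one_le_stretch_radicand hK ht
  rw [stretchFactor, one_le_div (Real.sqrt_pos.2 (by linarith)), Real.sqrt_le_left (by linarith)]
  nlinarith [mul_nonneg (show 0 ≤ K ^ 2 - 1 by nlinarith) (sq_nonneg t)]

lemma stretchFactor_le {K t : ℝ} (hK : 1 ≤ K) (ht : |t| ≤ 1) : stretchFactor K t ≤ K :=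
  div_le_self (by linarith) (Real.one_le_sqrt.2 (one_le_stretch_radicand hK ht))

lemma abs_stretchFactor_sub_le {K s t : ℝ} (hK : 1 ≤ K) (hs : |s| ≤ 1) (ht : |t| ≤ 1) :
    |stretchFactor K s - stretchFactor K t| ≤ K ^ 3 * |s - t| := by
  have h1 := one_le_stretch_radicand hK hs
  have h2 := one_le_stretch_radicand hK ht
  have r1 := Real.one_le_sqrt.2 h1
  have r2 := Real.one_le_sqrt.2 h2
  have q1 := Real.sq_sqrt (show 0 ≤ K ^ 2 + (1 - K ^ 2) * s ^ 2 by linarith)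
  have q2 := Real.sq_sqrt (show 0 ≤ K ^ 2 + (1 - K ^ 2) * t ^ 2 by linarith)
  unfold stretchFactor
  set a := √(K ^ 2 + (1 - K ^ 2) * s ^ 2)
  set b := √(K ^ 2 + (1 - K ^ 2) * t ^ 2)
  -- Rationalizing the difference of square roots. Both roots are at least 1, so the denominator is
  -- at least 2 and absorbs |s + t| ≤ 2.
  have e : K / a - K / b = K * (K ^ 2 - 1) * (s + t) * (s - t) / ((a * b) * (a + b)) := by
    have ha : a ≠ 0 := by positivity
    have hb : b ≠ 0 := by positivity
    have hab : a + b ≠ 0 := by positivity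
    field_simp
    linear_combination q2 - q1
  rw [e, abs_div, abs_of_pos (show 0 < a * b * (a + b) by positivity), abs_mul, abs_mul,
    abs_of_nonneg (mul_nonneg (by linarith : (0 : ℝ) ≤ K) (show 0 ≤ K ^ 2 - 1 by nlinarith)),
    div_le_iff₀ (by positivity)]
  have hst : |s + t| ≤ 2 := (abs_add_le s t).trans (by linarith)
  have hden : 2 ≤ a * b * (a + b) := by
    nlinarith [mul_nonneg (sub_nonneg.2 r1) (sub_nonneg.2 r2)]
  have h0 := abs_nonneg (s - t)
  calc K * (K ^ 2 - 1) * |s + t| * |s - t| ≤ K * K ^ 2 * 2 * |s - t| := by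
        gcongr; linarith
    _ = K ^ 3 * |s - t| * 2 := by ring
    _ ≤ K ^ 3 * |s - t| * (a * b * (a + b)) := by gcongr

lemma abs_log_sub_log_le {a b : ℝ} (ha : 1 ≤ a) (hb : 1 ≤ b) :
    |Real.log a - Real.log b| ≤ |a - b| := by
  have key : ∀ {a b : ℝ}, 1 ≤ a → 1 ≤ b → Real.log a - Real.log b ≤ |a - b| := by
    intro a b ha hb
    have hb0 : 0 < b := by linarith
    rw [← Real.log_div (by linarith) (by linarith)]
    have h := Real.log_le_sub_one_of_pos (show 0 < a / b by positivity)
    have e : a / b - 1 = (a - b) / b := by field_simp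
    rw [e] at h
    refine h.trans ((le_abs_self _).trans ?_)
    rw [abs_div, abs_of_pos hb0]
    exact div_le_self (abs_nonneg _) hb
  rw [abs_le]
  have := key hb ha
  rw [abs_sub_comm] at this
  exact ⟨by linarith, key ha hb⟩

lemma abs_log_stretchFactor_sub_le {K s t : ℝ} (hK : 1 ≤ K) (hs : |s| ≤ 1) (ht : |t| ≤ 1) :
    |Real.log (stretchFactor K s) - Real.log (stretchFactor K t)| ≤ K ^ 3 * |s - t| :=
  (abs_log_sub_log_le (one_le_stretchFactor hK hs) (one_le_stretchFactor hK ht)).trans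
    (abs_stretchFactor_sub_le hK hs ht)

lemma log_stretchFactor {K t : ℝ} (hK : 1 ≤ K) (ht : |t| ≤ 1) :
    Real.log (stretchFactor K t) =
      Real.log K - 1 / 2 * Real.log (K ^ 2 + (1 - K ^ 2) * t ^ 2) := by
  have h := one_le_stretch_radicand hK ht
  rw [stretchFactor, Real.log_div (by linarith) (Real.sqrt_pos.2 (by linarith)).ne',
    Real.log_sqrt (by linarith)]
  ring

lemma differentiableAt_stretchFactor {K t : ℝ} (hK : 1 ≤ K) (ht : |t| ≤ 1) :
    DifferentiableAt ℝ (stretchFactor K) t := by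
  have h := one_le_stretch_radicand hK ht
  refine DifferentiableAt.div (by fun_prop) (DifferentiableAt.sqrt (by fun_prop) (by linarith)) ?_
  exact (Real.sqrt_pos.2 (by linarith)).ne'

/-- The first coordinate of the direction of `y`. -/
def direction₁ (hn : 3 ≤ n) (y : EuclideanSpace ℝ (Fin n)) : ℝ := y (idx₁ hn) / ‖y‖

lemma abs_direction₁_le (hn : 3 ≤ n) (y : EuclideanSpace ℝ (Fin n)) : |direction₁ hn y| ≤ 1 := by
  rw [direction₁, abs_div, abs_norm]
  exact div_le_one_of_le₀ (abs_apply_le_norm _ _) (norm_nonneg _)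

lemma direction₁_smul (hn : 3 ≤ n) {c : ℝ} (hc : 0 < c) (y : EuclideanSpace ℝ (Fin n)) :
    direction₁ hn (c • y) = direction₁ hn y := by
  rw [direction₁, direction₁, norm_smul, Real.norm_eq_abs, abs_of_pos hc, PiLp.smul_apply,
    smul_eq_mul, mul_div_mul_left _ _ hc.ne']

/-- Homogeneity of degree 0 prevents a Lipschitz bound near the origin; the weight ‖y‖ restores it,
and it is supplied by the vector that the stretch factor multiplies. -/
lemma abs_direction₁_sub_mul_norm_le (hn : 3 ≤ n) (y z : EuclideanSpace ℝ (Fin n)) :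
    |direction₁ hn y - direction₁ hn z| * ‖y‖ ≤ 2 * ‖y - z‖ := by
  rcases eq_or_ne y 0 with rfl | hy
  · simp
  have hy' : ‖y‖ ≠ 0 := norm_ne_zero_iff.2 hy
  have e : (direction₁ hn y - direction₁ hn z) * ‖y‖ =
      (y - z) (idx₁ hn) + direction₁ hn z * (‖z‖ - ‖y‖) := by
    rcases eq_or_ne z 0 with rfl | hz
    · simp [direction₁, hy']
    have hz' : ‖z‖ ≠ 0 := norm_ne_zero_iff.2 hz
    simp only [direction₁, PiLp.sub_apply]
    field_simp
    ring
  nth_rewrite 1 [← abs_norm y]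
  rw [← abs_mul, e]
  refine (abs_add_le _ _).trans ?_
  rw [abs_mul]
  have h1 := abs_apply_le_norm (y - z) (idx₁ hn)
  have h2 := abs_direction₁_le hn z
  have h3 : |‖z‖ - ‖y‖| ≤ ‖y - z‖ := by rw [abs_sub_comm]; exact abs_norm_sub_norm_le y z
  nlinarith [mul_le_mul h2 h3 (abs_nonneg _) zero_le_one]

lemma spiralStretch_eq (hn : 3 ≤ n) (K α : ℝ) (y : EuclideanSpace ℝ (Fin n)) :
    spiralStretch hn K α y =
      stretchFactor K (direction₁ hn y) • planeRotation hn (α * Real.log ‖y‖) y := by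
  rw [spiralStretch, stretchFactor, direction₁, div_pow]

lemma norm_spiralStretch (hn : 3 ≤ n) {K : ℝ} (hK : 1 ≤ K) (α : ℝ)
    (y : EuclideanSpace ℝ (Fin n)) :
    ‖spiralStretch hn K α y‖ = stretchFactor K (direction₁ hn y) * ‖y‖ := by
  rw [spiralStretch_eq, norm_smul, norm_planeRotation, Real.norm_eq_abs, abs_of_nonneg]
  linarith [one_le_stretchFactor hK (abs_direction₁_le hn y)]

lemma norm_le_norm_spiralStretch (hn : 3 ≤ n) {K : ℝ} (hK : 1 ≤ K) (α : ℝ)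
    (y : EuclideanSpace ℝ (Fin n)) : ‖y‖ ≤ ‖spiralStretch hn K α y‖ := by
  rw [norm_spiralStretch hn hK]
  exact le_mul_of_one_le_left (norm_nonneg _) (one_le_stretchFactor hK (abs_direction₁_le hn y))

lemma abs_log_sub_mul_le {a b : ℝ} (ha : 0 ≤ a) (hab : a ≤ b) :
    |Real.log a - Real.log b| * a ≤ |a - b| := by
  rcases ha.eq_or_lt with rfl | ha
  · simp
  have hb : 0 < b := ha.trans_le hab
  have h := Real.log_le_sub_one_of_pos (show 0 < b / a by positivity)
  rw [Real.log_div hb.ne' ha.ne'] at h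
  have h' := Real.log_le_log ha hab
  rw [abs_of_nonpos (by linarith), abs_of_nonpos (by linarith)]
  calc -(Real.log a - Real.log b) * a ≤ (b / a - 1) * a := by gcongr; linarith
    _ = -(a - b) := by field_simp; ring

/-- The angle α log r varies at rate |α| / r, but it turns a vector of length r. Rotating the
shorter of the two vectors makes this cancellation exact through `abs_log_sub_mul_le`. -/
lemma norm_spiral_sub_le (hn : 3 ≤ n) (α : ℝ) (y z : EuclideanSpace ℝ (Fin n)) :
    ‖planeRotation hn (α * Real.log ‖y‖) y - planeRotation hn (α * Real.log ‖z‖) z‖ ≤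
      (1 + 2 * |α|) * ‖y - z‖ := by
  wlog hyz : ‖y‖ ≤ ‖z‖ generalizing y z
  · have := this z y (le_of_not_ge hyz)
    rwa [norm_sub_rev, norm_sub_rev z y] at this
  have e : planeRotation hn (α * Real.log ‖y‖) y - planeRotation hn (α * Real.log ‖z‖) z =
      (planeRotation hn (α * Real.log ‖y‖) y - planeRotation hn (α * Real.log ‖z‖) y) +
        planeRotation hn (α * Real.log ‖z‖) (y - z) := by
    rw [planeRotation_sub]; abel
  rw [e]
  refine (norm_add_le _ _).trans ?_
  rw [norm_planeRotation]
  have h1 := norm_planeRotation_sub_le hn (α * Real.log ‖y‖) (α * Real.log ‖z‖) y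
  rw [← mul_sub, abs_mul] at h1
  have h2 := abs_log_sub_mul_le (norm_nonneg y) hyz
  have h3 := abs_norm_sub_norm_le y z
  have h4 := mul_le_mul_of_nonneg_left (h2.trans h3) (abs_nonneg α)
  linarith

lemma lipschitzWith_spiralStretch (hn : 3 ≤ n) {K α : ℝ} (hK : 1 ≤ K) (hα : |α| ≤ 1) :
    LipschitzWith (Real.toNNReal (2 * K ^ 3 + 3 * K)) (spiralStretch hn K α) := by
  refine LipschitzWith.of_dist_le_mul fun y z => ?_
  rw [dist_eq_norm, dist_eq_norm, Real.coe_toNNReal _ (by positivity), spiralStretch_eq,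
    spiralStretch_eq]
  have hy := abs_direction₁_le hn y
  have hz := abs_direction₁_le hn z
  set c := stretchFactor K (direction₁ hn y)
  set d := stretchFactor K (direction₁ hn z) with hd
  set P := planeRotation hn (α * Real.log ‖y‖) y with hP
  set Q := planeRotation hn (α * Real.log ‖z‖) z
  have e : c • P - d • Q = (c - d) • P + d • (P - Q) := by module
  rw [e]
  refine (norm_add_le _ _).trans ?_
  rw [norm_smul, norm_smul, hP, norm_planeRotation, ← hP, Real.norm_eq_abs, Real.norm_eq_abs]
  have h1 : |c - d| * ‖y‖ ≤ 2 * K ^ 3 * ‖y - z‖ := by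
    calc |c - d| * ‖y‖ ≤ K ^ 3 * |direction₁ hn y - direction₁ hn z| * ‖y‖ := by
          gcongr; exact abs_stretchFactor_sub_le hK hy hz
      _ = K ^ 3 * (|direction₁ hn y - direction₁ hn z| * ‖y‖) := by ring
      _ ≤ K ^ 3 * (2 * ‖y - z‖) := by
          exact mul_le_mul_of_nonneg_left (abs_direction₁_sub_mul_norm_le hn y z) (by positivity)
      _ = _ := by ring
  have h2 : |d| * ‖P - Q‖ ≤ 3 * K * ‖y - z‖ := by
    have hd1 : |d| ≤ K := by
      rw [abs_of_nonneg (by linarith [one_le_stretchFactor hK hz])]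
      exact stretchFactor_le hK hz
    calc |d| * ‖P - Q‖ ≤ K * ((1 + 2 * 1) * ‖y - z‖) := by
          gcongr
          exact (norm_spiral_sub_le hn α y z).trans (by gcongr)
      _ = _ := by ring
  linarith

/-- `R_s` in logarithmic polar coordinates. -/
lemma spiralStretch_polar (hn : 3 ≤ n) (K α t : ℝ) {ν : EuclideanSpace ℝ (Fin n)}
    (hν : ‖ν‖ = 1) :
    spiralStretch hn K α (Real.exp t • ν) =
      (Real.exp t * stretchFactor K (ν (idx₁ hn))) • planeRotation hn (α * t) ν := by
  have h0 := Real.exp_pos t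
  rw [spiralStretch_eq, direction₁_smul hn h0, direction₁, hν, div_one, norm_smul, hν, mul_one,
    Real.norm_eq_abs, abs_of_pos h0, Real.log_exp, planeRotation_smul, smul_smul, mul_comm]

lemma exists_polar {V : Type*} [NormedAddCommGroup V] [NormedSpace ℝ V] {y : V} (hy : y ≠ 0) :
    ∃ (t : ℝ) (ν : V), ‖ν‖ = 1 ∧ y = Real.exp t • ν := by
  have h := norm_pos_iff.2 hy
  refine ⟨Real.log ‖y‖, ‖y‖⁻¹ • y, ?_, ?_⟩
  · rw [norm_smul, norm_inv, norm_norm, inv_mul_cancel₀ h.ne']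
  · rw [Real.exp_log h, smul_inv_smul₀ h.ne']

@[simp] lemma spiralStretch_zero (hn : 3 ≤ n) (K α : ℝ) :
    spiralStretch hn K α (0 : EuclideanSpace ℝ (Fin n)) = 0 := by
  rw [spiralStretch, planeRotation_zero_right, smul_zero]

/-- A contraction argument in polar coordinates: equality of images bounds the difference of
directions by 2|α||s - t| and bounds |s - t| by K³ times the difference of directions. The
hypothesis on α makes the product of the constants less than 1. -/
lemma spiralStretch_injective (hn : 3 ≤ n) {K α : ℝ} (hK : 1 ≤ K) (hα : 2 * K ^ 3 * |α| < 1) :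
    Function.Injective (spiralStretch hn K α : EuclideanSpace ℝ (Fin n) → _) := by
  have hzero : ∀ y : EuclideanSpace ℝ (Fin n), spiralStretch hn K α y = 0 → y = 0 := by
    intro y hy
    have := norm_le_norm_spiralStretch hn hK α y
    rw [hy, norm_zero] at this
    exact norm_le_zero_iff.1 this
  intro y z hyz
  rcases eq_or_ne y 0 with rfl | hy
  · rw [spiralStretch_zero] at hyz
    exact (hzero z hyz.symm).symm
  rcases eq_or_ne z 0 with rfl | hz
  · rw [spiralStretch_zero] at hyz
    exact hzero y hyz
  obtain ⟨s, ν, hν, rfl⟩ := exists_polar hy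
  obtain ⟨t, η, hη, rfl⟩ := exists_polar hz
  rw [spiralStretch_polar hn K α s hν, spiralStretch_polar hn K α t hη] at hyz
  have hν1 : |ν (idx₁ hn)| ≤ 1 := hν ▸ abs_apply_le_norm ν (idx₁ hn)
  have hη1 : |η (idx₁ hn)| ≤ 1 := hη ▸ abs_apply_le_norm η (idx₁ hn)
  have cν : 0 < stretchFactor K (ν (idx₁ hn)) := by linarith [one_le_stretchFactor hK hν1]
  have cη : 0 < stretchFactor K (η (idx₁ hn)) := by linarith [one_le_stretchFactor hK hη1]
  have hnorm : Real.exp s * stretchFactor K (ν (idx₁ hn)) =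
      Real.exp t * stretchFactor K (η (idx₁ hn)) := by
    have := congrArg norm hyz
    rwa [norm_smul, norm_smul, norm_planeRotation, norm_planeRotation, hν, hη, mul_one, mul_one,
      Real.norm_eq_abs, Real.norm_eq_abs, abs_of_pos (by positivity),
      abs_of_pos (by positivity)] at this
  have hrot : planeRotation hn (α * s) ν = planeRotation hn (α * t) η := by
    rw [hnorm] at hyz
    exact smul_right_injective _ (show Real.exp t * stretchFactor K (η (idx₁ hn)) ≠ 0 by
      positivity) hyz
  have hlog : s - t = Real.log (stretchFactor K (η (idx₁ hn))) -
      Real.log (stretchFactor K (ν (idx₁ hn))) := by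
    have := congrArg Real.log hnorm
    rw [Real.log_mul (Real.exp_pos _).ne' cν.ne', Real.log_mul (Real.exp_pos _).ne' cη.ne',
      Real.log_exp, Real.log_exp] at this
    linarith
  have hν' : ν = planeRotation hn (α * t - α * s) η := by
    have := congrArg (planeRotation hn (-(α * s))) hrot
    rwa [planeRotation_planeRotation, planeRotation_planeRotation, neg_add_cancel,
      planeRotation_zero, neg_add_eq_sub] at this
  have hdist : ‖ν - η‖ ≤ 2 * |α| * |s - t| := by
    have := norm_planeRotation_sub_le hn (α * t - α * s) 0 η
    rw [planeRotation_zero, ← hν', sub_zero, hη, mul_one, ← mul_sub, abs_mul,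
      abs_sub_comm t s] at this
    linarith
  have hst : |s - t| ≤ K ^ 3 * ‖ν - η‖ := by
    rw [hlog]
    refine (abs_log_stretchFactor_sub_le hK hη1 hν1).trans ?_
    rw [abs_sub_comm]
    gcongr
    exact abs_apply_le_norm (ν - η) (idx₁ hn)
  have hst0 : |s - t| = 0 := by
    have h1 : |s - t| ≤ 2 * K ^ 3 * |α| * |s - t| := by
      calc |s - t| ≤ K ^ 3 * ‖ν - η‖ := hst
        _ ≤ K ^ 3 * (2 * |α| * |s - t|) := by gcongr
        _ = _ := by ring
    nlinarith [abs_nonneg (s - t)]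
  have hst1 : s = t := sub_eq_zero.1 (abs_eq_zero.1 hst0)
  rw [hst1, sub_self, planeRotation_zero] at hν'
  rw [hst1, hν']

lemma contDiff_planeRotation (hn : 3 ≤ n) {k : WithTop ℕ∞} :
    ContDiff ℝ k fun p : ℝ × EuclideanSpace ℝ (Fin n) => planeRotation hn p.1 p.2 := by
  rw [contDiff_euclidean]
  intro i
  simp only [planeRotation]
  have h : ∀ j, ContDiff ℝ k fun p : ℝ × EuclideanSpace ℝ (Fin n) => p.2 j := fun j =>
    (EuclideanSpace.proj (𝕜 := ℝ) j).contDiff.comp contDiff_snd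
  have h1 := h (idx₁ hn)
  have h2 := h (idx₂ hn)
  split_ifs
  · exact (h1.mul contDiff_fst.cos).sub (h2.mul contDiff_fst.sin)
  · exact (h1.mul contDiff_fst.sin).add (h2.mul contDiff_fst.cos)
  · exact h i

/-- Undoing the rotation determines the direction of a preimage from its log-radius t, leaving one
scalar equation. It is solved by the intermediate value theorem, for every α. -/
lemma spiralStretch_surjective (hn : 3 ≤ n) {K : ℝ} (hK : 1 ≤ K) (α : ℝ) :
    Function.Surjective (spiralStretch hn K α : EuclideanSpace ℝ (Fin n) → _) := by
  intro w
  rcases eq_or_ne w 0 with rfl | hw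
  · exact ⟨0, spiralStretch_zero hn K α⟩
  obtain ⟨τ, ζ, hζ, rfl⟩ := exists_polar hw
  have hb : ∀ t, |planeRotation hn (-(α * t)) ζ (idx₁ hn)| ≤ 1 := fun t => by
    refine (abs_apply_le_norm _ _).trans ?_
    rw [norm_planeRotation, hζ]
  have hcont : Continuous fun t : ℝ =>
      t + Real.log (stretchFactor K (planeRotation hn (-(α * t)) ζ (idx₁ hn))) := by
    refine continuous_id.add (continuous_iff_continuousAt.2 fun t => ?_)
    have h1 : ContinuousAt (fun t : ℝ => planeRotation hn (-(α * t)) ζ (idx₁ hn)) t := by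
      simp only [planeRotation_idx₁]
      fun_prop
    have h2 := (differentiableAt_stretchFactor hK (hb t)).continuousAt
    refine ContinuousAt.log (ContinuousAt.comp (g := stretchFactor K) h2 h1) ?_
    linarith [one_le_stretchFactor hK (hb t)]
  have hlo := Real.log_nonneg (one_le_stretchFactor hK (hb τ))
  have hhi := Real.log_le_log (by linarith [one_le_stretchFactor hK (hb (τ - Real.log K))])
    (stretchFactor_le hK (hb (τ - Real.log K)))
  -- The added logarithm lies in [0, log K], so the value is at most τ at the left endpoint and at
  -- least τ at the right one.
  obtain ⟨t, -, ht⟩ := intermediate_value_Icc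
    (show τ - Real.log K ≤ τ by linarith [Real.log_nonneg hK]) hcont.continuousOn
    (show τ ∈ Set.Icc _ _ from ⟨by linarith, by linarith⟩)
  refine ⟨Real.exp t • planeRotation hn (-(α * t)) ζ, ?_⟩
  rw [spiralStretch_polar hn K α t (by rw [norm_planeRotation, hζ]),
    planeRotation_planeRotation, add_neg_cancel, planeRotation_zero]
  have hpos : 0 < stretchFactor K (planeRotation hn (-(α * t)) ζ (idx₁ hn)) := by
    linarith [one_le_stretchFactor hK (hb t)]
  rw [← ht, Real.exp_add, Real.exp_log hpos]

lemma isHomeomorph_spiralStretch (hn : 3 ≤ n) {K α : ℝ} (hK : 1 ≤ K) (hα₁ : |α| ≤ 1)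
    (hα : 2 * K ^ 3 * |α| < 1) :
    IsHomeomorph (spiralStretch hn K α : EuclideanSpace ℝ (Fin n) → _) := by
  have hcont := (lipschitzWith_spiralStretch hn hK hα₁).continuous
  refine isHomeomorph_iff_continuous_isClosedMap_bijective.2 ⟨hcont, ?_,
    spiralStretch_injective hn hK hα, spiralStretch_surjective hn hK α⟩
  -- Norms do not decrease, so the map is proper and hence closed.
  refine (isProperMap_iff_tendsto_cocompact.2 ⟨hcont, ?_⟩).isClosedMap
  rw [← Metric.cobounded_eq_cocompact, ← tendsto_norm_atTop_iff_cobounded]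
  exact Filter.tendsto_atTop_mono (norm_le_norm_spiralStretch hn hK α) tendsto_norm_cobounded_atTop

lemma differentiableAt_direction₁ (hn : 3 ≤ n) {y : EuclideanSpace ℝ (Fin n)} (hy : y ≠ 0) :
    DifferentiableAt ℝ (direction₁ hn) y := by
  have h₁ : DifferentiableAt ℝ (fun z : EuclideanSpace ℝ (Fin n) => z (idx₁ hn)) y :=
    (EuclideanSpace.proj (𝕜 := ℝ) (idx₁ hn)).differentiableAt
  have h₂ : DifferentiableAt ℝ (fun z : EuclideanSpace ℝ (Fin n) => ‖z‖) y :=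
    differentiableAt_fun_id.norm ℝ hy
  change DifferentiableAt ℝ (fun z : EuclideanSpace ℝ (Fin n) => z (idx₁ hn) / ‖z‖) y
  simp only [div_eq_mul_inv]
  exact h₁.fun_mul (h₂.fun_inv (norm_ne_zero_iff.2 hy))

lemma differentiableAt_stretchFactor_direction₁ (hn : 3 ≤ n) {K : ℝ} (hK : 1 ≤ K)
    {y : EuclideanSpace ℝ (Fin n)} (hy : y ≠ 0) :
    DifferentiableAt ℝ (fun z => stretchFactor K (direction₁ hn z)) y :=
  (differentiableAt_stretchFactor hK (abs_direction₁_le hn y)).comp y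
    (differentiableAt_direction₁ hn hy)

lemma differentiableAt_spiralStretch (hn : 3 ≤ n) {K : ℝ} (hK : 1 ≤ K) (α : ℝ)
    {y : EuclideanSpace ℝ (Fin n)} (hy : y ≠ 0) :
    DifferentiableAt ℝ (spiralStretch hn K α) y := by
  have h1 : DifferentiableAt ℝ (fun z : EuclideanSpace ℝ (Fin n) => (α * Real.log ‖z‖, z)) y :=
    (((differentiableAt_fun_id.norm ℝ hy).log (norm_ne_zero_iff.2 hy)).const_mul α).prodMk
      differentiableAt_fun_id
  have h2 : DifferentiableAt ℝ (fun z => planeRotation hn (α * Real.log ‖z‖) z) y :=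
    ((contDiff_planeRotation hn (k := 1)).differentiable one_ne_zero
      (α * Real.log ‖y‖, y)).comp (f := fun z => (α * Real.log ‖z‖, z)) y h1
  exact ((differentiableAt_stretchFactor_direction₁ hn hK hy).smul h2).congr_of_eventuallyEq
    (Filter.Eventually.of_forall fun z => spiralStretch_eq hn K α z)

/-- The rotation as a continuous linear map. -/
def rotationCLM (hn : 3 ≤ n) (θ : ℝ) : EuclideanSpace ℝ (Fin n) →L[ℝ] EuclideanSpace ℝ (Fin n) :=
  LinearMap.toContinuousLinearMap (rotationL hn θ)

lemma rotationCLM_apply (hn : 3 ≤ n) (θ : ℝ) (x : EuclideanSpace ℝ (Fin n)) :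
    rotationCLM hn θ x = planeRotation hn θ x := rfl

open Filter Topology in
/-- The Jacobian of the stretch composed with a fixed rotation. -/
lemma one_le_det_fderiv_stretch_rotation (hn : 3 ≤ n) {K : ℝ} (hK : 1 ≤ K) (θ : ℝ)
    {y : EuclideanSpace ℝ (Fin n)} (hy : y ≠ 0) :
    DifferentiableAt ℝ (fun z => stretchFactor K (direction₁ hn z) • rotationCLM hn θ z) y ∧
    1 ≤ (fderiv ℝ (fun z => stretchFactor K (direction₁ hn z) • rotationCLM hn θ z) y).det := by
  have hc := differentiableAt_stretchFactor_direction₁ hn hK hy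
  have hd := hc.hasFDerivAt.fun_smul (rotationCLM hn θ).hasFDerivAt (x := y)
  refine ⟨hd.differentiableAt, ?_⟩
  have h1 := one_le_stretchFactor hK (abs_direction₁_le hn y)
  rw [hd.fderiv]
  set c' := fderiv ℝ (fun z => stretchFactor K (direction₁ hn z)) y with hc'
  set c := stretchFactor K (direction₁ hn y)
  have hc0 : c ≠ 0 := by linarith
  have hrad : c' y = 0 := by
    refine fderiv_apply_eq_zero_of_eventually_eq hc ?_
    filter_upwards [lt_mem_nhds (show (-1 : ℝ) < 0 by norm_num)] with t ht
    rw [show y + t • y = (1 + t) • y by module, direction₁_smul hn (by linarith)]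
  -- The derivative is v ↦ c ρ(v + c⁻¹ c'(v) y) with c'(y) = 0: the transvection has determinant 1,
  -- and the total is cⁿ.
  rw [ContinuousLinearMap.det, LinearMap.det_eq_of_forall_apply (ρ := rotationL hn θ) (l := c)
    (a := (c⁻¹ • c' : _ →L[ℝ] ℝ).toLinearMap) (b := 0) (p := y) (e := 0) ?_
    (det_rotationL hn θ) (by simp [hrad]) (by simp)]
  · simpa using one_le_pow₀ h1
  · intro v
    simp only [ContinuousLinearMap.coe_coe, add_apply, smul_apply,
      ContinuousLinearMap.smulRight_apply, rotationCLM_apply,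
      rotationL_apply, planeRotation_add, planeRotation_smul, smul_add, smul_smul, smul_eq_mul,
      LinearMap.zero_apply, smul_zero, add_zero]
    rw [mul_inv_cancel_left₀ hc0]

-- Comparison with the map whose angle is frozen at y, of Jacobian at least 1. The derivatives
-- differ by at most 4K|α|, uniformly in y, so for small α the determinant drops by less than 1/2.
open Filter Topology in
lemma exists_det_spiralStretch (hn : 3 ≤ n) {K : ℝ} (hK : 1 ≤ K) :
    ∃ α₀ > 0, ∀ α : ℝ, |α| < α₀ → ∀ y : EuclideanSpace ℝ (Fin n), y ≠ 0 →
      1 / 2 ≤ (fderiv ℝ (spiralStretch hn K α) y).det := by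
  set L : ℝ := 2 * K ^ 3 + 3 * K with hL
  obtain ⟨δ, hδ, h⟩ := ContinuousLinearMap.exists_forall_det_sub_lt
    (V := EuclideanSpace ℝ (Fin n)) (L + 4 * K) (show (0 : ℝ) < 1 / 2 by norm_num)
  refine ⟨min 1 (δ / (4 * K)), by positivity, fun α hα y hy => ?_⟩
  have hα1 : |α| < 1 := hα.trans_le (min_le_left _ _)
  have hα2 : 4 * K * |α| < δ := by
    have := hα.trans_le (min_le_right _ _)
    rwa [lt_div_iff₀ (by positivity), mul_comm] at this
  obtain ⟨hG, hGdet⟩ := one_le_det_fderiv_stretch_rotation hn hK (α * Real.log ‖y‖) hy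
  set G := fun z => stretchFactor K (direction₁ hn z) • rotationCLM hn (α * Real.log ‖y‖) z
  have hF := differentiableAt_spiralStretch hn hK α hy
  have hFn : ‖fderiv ℝ (spiralStretch hn K α) y‖ ≤ L := by
    have := norm_fderiv_le_of_lipschitz ℝ (x₀ := y) (lipschitzWith_spiralStretch hn hK hα1.le)
    rwa [Real.coe_toNNReal _ (by positivity)] at this
  have hFG : ‖fderiv ℝ (spiralStretch hn K α) y - fderiv ℝ G y‖ ≤ 4 * K * |α| := by
    refine (hF.hasFDerivAt.sub hG.hasFDerivAt).le_of_lip' (by positivity) ?_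
    have hy0 := norm_pos_iff.2 hy
    -- The logarithmic estimate carries the smaller of the two norms as weight; restricting to ‖z‖ <
    -- 2‖y‖ lets ‖z‖ replace it at the cost of a factor 2.
    filter_upwards [(continuous_norm.tendsto y).eventually
      (gt_mem_nhds (show ‖y‖ < 2 * ‖y‖ by linarith))] with z hz
    have e0 : spiralStretch hn K α y - G y = 0 := by
      rw [spiralStretch_eq]; simp [G, rotationCLM_apply]
    have e1 : spiralStretch hn K α z - G z = stretchFactor K (direction₁ hn z) •
        (planeRotation hn (α * Real.log ‖z‖) z - planeRotation hn (α * Real.log ‖y‖) z) := by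
      rw [spiralStretch_eq, smul_sub]; simp [G, rotationCLM_apply]
    simp only [Pi.sub_apply, e0, sub_zero]
    rw [e1, norm_smul, Real.norm_eq_abs, abs_of_nonneg
      (by linarith [one_le_stretchFactor hK (abs_direction₁_le hn z)])]
    have h1 : |Real.log ‖z‖ - Real.log ‖y‖| * ‖z‖ ≤ 2 * |‖z‖ - ‖y‖| := by
      rcases le_total ‖z‖ ‖y‖ with hzy | hzy
      · have := abs_log_sub_mul_le (norm_nonneg z) hzy
        linarith [abs_nonneg (‖z‖ - ‖y‖)]
      · have := abs_log_sub_mul_le hy0.le hzy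
        rw [abs_sub_comm, abs_sub_comm ‖y‖] at this
        nlinarith [abs_nonneg (Real.log ‖z‖ - Real.log ‖y‖)]
    have h2 := norm_planeRotation_sub_le hn (α * Real.log ‖z‖) (α * Real.log ‖y‖) z
    rw [← mul_sub, abs_mul] at h2
    have h3 := abs_norm_sub_norm_le z y
    calc stretchFactor K (direction₁ hn z) * _ ≤ K * (2 * (|α| * |Real.log ‖z‖ - Real.log ‖y‖|) *
          ‖z‖) := by
          gcongr
          exact stretchFactor_le hK (abs_direction₁_le hn z)
      _ = 2 * K * |α| * (|Real.log ‖z‖ - Real.log ‖y‖| * ‖z‖) := by ring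
      _ ≤ 2 * K * |α| * (2 * ‖z - y‖) :=
          mul_le_mul_of_nonneg_left (by linarith) (by positivity)
      _ = _ := by ring
  have hGn : ‖fderiv ℝ G y‖ ≤ L + 4 * K := by
    have h1 := norm_sub_le (fderiv ℝ (spiralStretch hn K α) y)
      (fderiv ℝ (spiralStretch hn K α) y - fderiv ℝ G y)
    rw [sub_sub_cancel] at h1
    have : 4 * K * |α| ≤ 4 * K * 1 := by gcongr
    linarith
  have := h _ _ (hFn.trans (by linarith)) hGn (hFG.trans_lt hα2)
  linarith

lemma exists_isQuasiconformalOn_spiralStretch (hn : 3 ≤ n) {K : ℝ} (hK : 1 ≤ K) :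
    ∃ α₀ > 0, ∀ α : ℝ, |α| < α₀ →
      IsHomeomorph (spiralStretch hn K α : EuclideanSpace ℝ (Fin n) → _) ∧
      IsQuasiconformalOn (spiralStretch hn K α : EuclideanSpace ℝ (Fin n) → _) Set.univ := by
  obtain ⟨α₁, hα₁, h⟩ := exists_det_spiralStretch hn hK
  refine ⟨min α₁ (min 1 (1 / (2 * K ^ 3))), by positivity, fun α hα => ?_⟩
  have h1 : |α| < α₁ := hα.trans_le (min_le_left _ _)
  have h2 : |α| < 1 := hα.trans_le ((min_le_right _ _).trans (min_le_left _ _))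
  have h3 : 2 * K ^ 3 * |α| < 1 := by
    have := hα.trans_le ((min_le_right _ _).trans (min_le_right _ _))
    rwa [lt_div_iff₀ (by positivity), mul_comm] at this
  refine ⟨isHomeomorph_spiralStretch hn hK h2.le h3, ?_,
    (spiralStretch_injective hn hK h3).injOn⟩
  refine isQuasiregularOn_of_lipschitzOnWith (c := 1 / 2) isOpen_univ isConnected_univ
    (lipschitzWith_spiralStretch hn hK h2.le).lipschitzOnWith (by norm_num) ?_
  have : Nonempty (Fin n) := ⟨idx₁ hn⟩
  rw [Measure.restrict_univ]
  filter_upwards [Measure.ae_ne volume (0 : EuclideanSpace ℝ (Fin n))] with y hy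
  exact h α h1 y hy

/-! ### The Zorich map on the fundamental set -/

lemma cellIndex_of_abs_lt {t : ℝ} (ht : |t| < Real.pi / 2) : cellIndex t = 0 := by
  have hp := Real.pi_pos
  rw [abs_lt] at ht
  rw [cellIndex, round_eq, Int.floor_eq_iff]
  have h1 : -(1 / 2) < t / Real.pi := by rw [lt_div_iff₀ hp]; linarith
  have h2 : t / Real.pi < 1 / 2 := by rw [div_lt_iff₀ hp]; linarith
  constructor <;> push_cast <;> linarith

lemma cellIndex_of_abs_sub_pi_lt {t : ℝ} (ht : |t - Real.pi| < Real.pi / 2) :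
    cellIndex t = 1 := by
  have hp := Real.pi_pos
  rw [abs_lt] at ht
  rw [cellIndex, round_eq, Int.floor_eq_iff]
  have h1 : 1 / 2 < t / Real.pi := by rw [lt_div_iff₀ hp]; linarith
  have h2 : t / Real.pi < 3 / 2 := by rw [div_lt_iff₀ hp]; linarith
  constructor <;> push_cast <;> linarith

lemma foldReal_of_abs_sub_pi_lt {t : ℝ} (ht : |t - Real.pi| < Real.pi / 2) :
    foldReal t = Real.pi - t := by
  rw [foldReal, cellIndex_of_abs_sub_pi_lt ht]; simp

lemma foldReal_of_abs_le {t : ℝ} (ht : |t| ≤ Real.pi / 2) : foldReal t = t := by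
  have hp := Real.pi_pos
  rcases ht.lt_or_eq with h | h
  · rw [foldReal, cellIndex_of_abs_lt h]; simp
  -- Rounding sends half-integers up, so π/2 has cell index 1 and -π/2 has index 0; folding fixes
  -- both.
  rcases (abs_eq (by linarith)).1 h with rfl | rfl
  · have : cellIndex (Real.pi / 2) = 1 := by
      rw [cellIndex, round_eq, Int.floor_eq_iff]
      have : Real.pi / 2 / Real.pi = 1 / 2 := by field_simp
      rw [this]; norm_num
    rw [foldReal, this]; simp; ring
  · have : cellIndex (-(Real.pi / 2)) = 0 := by
      rw [cellIndex, round_eq, Int.floor_eq_iff]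
      have : -(Real.pi / 2) / Real.pi = -(1 / 2) := by field_simp
      rw [this]; norm_num
    rw [foldReal, this]; simp

lemma mem_closedCell_iff (hn : 3 ≤ n) {x : EuclideanSpace ℝ (Fin n)} :
    x ∈ closedCell hn ↔ cubeNorm hn x ≤ Real.pi / 2 := (cubeNorm_le_iff hn).symm

lemma mem_openCell_iff (hn : 3 ≤ n) {x : EuclideanSpace ℝ (Fin n)} :
    x ∈ openCell hn ↔ cubeNorm hn x < Real.pi / 2 := by
  refine ⟨fun h => ?_, fun h i hi => (abs_le_cubeNorm hn x hi).trans_lt h⟩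
  obtain ⟨i, hi, h'⟩ := exists_abs_eq_cubeNorm hn x
  rw [← h']
  exact h i hi

lemma openCell_subset_closedCell (hn : 3 ≤ n) : openCell hn ⊆ closedCell hn :=
  fun _ hx i hi => (hx i hi).le

/-- The formula for the Zorich map on the closed cell, in vector form. -/
lemma zorichBase_eq (hn : 3 ≤ n) (x : EuclideanSpace ℝ (Fin n)) :
    zorichBase hn x = Real.exp (x (idxLast hn)) •
      ((Real.sin (cubeNorm hn x) / ‖horiz hn x‖) • horiz hn x +
        Real.cos (cubeNorm hn x) • axis hn) := by
  ext i
  simp only [zorichBase, horizNorm_eq_norm, PiLp.smul_apply, PiLp.add_apply, smul_eq_mul]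
  split_ifs with hi
  · subst hi
    simp [axis]
  · rw [horiz_apply hn x hi]
    simp [axis, hi]
    ring

lemma horiz_axis (hn : 3 ≤ n) : horiz hn (axis hn) = 0 := by
  rw [horiz_eq]; simp [axis]

lemma horiz_horiz (hn : 3 ≤ n) (x : EuclideanSpace ℝ (Fin n)) :
    horiz hn (horiz hn x) = horiz hn x := by
  rw [horiz_eq, horiz_last, zero_smul, sub_zero]

@[simp] lemma axis_last (hn : 3 ≤ n) : axis hn (idxLast hn) = 1 := by simp [axis]

lemma eq_horiz_add (hn : 3 ≤ n) (x : EuclideanSpace ℝ (Fin n)) :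
    x = horiz hn x + x (idxLast hn) • axis hn := by
  rw [horiz_eq, sub_add_cancel]

lemma ext_horiz (hn : 3 ≤ n) {x y : EuclideanSpace ℝ (Fin n)} (h : horiz hn x = horiz hn y)
    (h' : x (idxLast hn) = y (idxLast hn)) : x = y := by
  rw [eq_horiz_add hn x, eq_horiz_add hn y, h, h']

lemma horiz_zorichBase (hn : 3 ≤ n) (x : EuclideanSpace ℝ (Fin n)) :
    horiz hn (zorichBase hn x) = (Real.exp (x (idxLast hn)) *
      (Real.sin (cubeNorm hn x) / ‖horiz hn x‖)) • horiz hn x := by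
  rw [zorichBase_eq, map_smul, map_add, map_smul, map_smul, horiz_axis, horiz_horiz, smul_zero,
    add_zero, smul_smul]

lemma zorichBase_last (hn : 3 ≤ n) (x : EuclideanSpace ℝ (Fin n)) :
    zorichBase hn x (idxLast hn) = Real.exp (x (idxLast hn)) * Real.cos (cubeNorm hn x) := by
  simp [zorichBase]

lemma norm_div_norm_smul_horiz (hn : 3 ≤ n) (x : EuclideanSpace ℝ (Fin n)) :
    ‖(Real.sin (cubeNorm hn x) / ‖horiz hn x‖) • horiz hn x‖ = |Real.sin (cubeNorm hn x)| := by
  rcases eq_or_ne (horiz hn x) 0 with h | h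
  · rw [(cubeNorm_eq_zero_iff hn x).2 h]; simp
  · rw [norm_smul, norm_div, norm_norm, div_mul_cancel₀ _ (norm_ne_zero_iff.2 h), Real.norm_eq_abs]

lemma norm_zorichBase (hn : 3 ≤ n) (x : EuclideanSpace ℝ (Fin n)) :
    ‖zorichBase hn x‖ = Real.exp (x (idxLast hn)) := by
  rw [← sq_eq_sq₀ (norm_nonneg _) (Real.exp_pos _).le, norm_sq_eq_horiz hn, horiz_zorichBase,
    zorichBase_last, mul_smul, norm_smul, norm_div_norm_smul_horiz, mul_pow, mul_pow, sq_abs,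
    Real.norm_eq_abs, sq_abs]
  linear_combination (Real.exp (x (idxLast hn)) ^ 2) * Real.sin_sq_add_cos_sq (cubeNorm hn x)

/-- The coordinates are recovered in turn: the norm gives xₙ, the last coordinate gives M because
cosine is injective on [0, π], and the horizontal direction together with M gives x'. -/
lemma zorichBase_injOn (hn : 3 ≤ n) : Set.InjOn (zorichBase hn) (closedCell hn) := by
  intro x hx y hy hxy
  have hp := Real.pi_pos
  rw [mem_closedCell_iff] at hx hy
  have hlast : x (idxLast hn) = y (idxLast hn) := by
    have := congrArg norm hxy
    rw [norm_zorichBase, norm_zorichBase] at this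
    exact Real.exp_injective this
  have he := (Real.exp_pos (y (idxLast hn))).ne'
  have hM : cubeNorm hn x = cubeNorm hn y := by
    have := congrArg (fun z => z (idxLast hn)) hxy
    simp only [zorichBase_last, hlast] at this
    exact Real.injOn_cos ⟨cubeNorm_nonneg hn x, by linarith⟩ ⟨cubeNorm_nonneg hn y, by linarith⟩
      (mul_left_cancel₀ he this)
  refine ext_horiz hn ?_ hlast
  rcases (cubeNorm_nonneg hn y).eq_or_lt with h0 | h0
  · rw [(cubeNorm_eq_zero_iff hn x).1 (hM.trans h0.symm), (cubeNorm_eq_zero_iff hn y).1 h0.symm]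
  have hsin := (Real.sin_pos_of_pos_of_lt_pi h0 (by linarith)).ne'
  have hx0 : ‖horiz hn x‖ ≠ 0 := by
    rw [norm_ne_zero_iff, ne_eq, ← cubeNorm_eq_zero_iff, hM]; exact h0.ne'
  have hy0 : ‖horiz hn y‖ ≠ 0 := by
    rw [norm_ne_zero_iff, ne_eq, ← cubeNorm_eq_zero_iff]; exact h0.ne'
  have hH := congrArg (horiz hn) hxy
  rw [horiz_zorichBase, horiz_zorichBase, hlast, hM] at hH
  -- The horizontal parts are known up to scalars; taking M of both sides shows that the scalars
  -- agree.
  have hc := congrArg (cubeNorm hn) hH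
  rw [cubeNorm_smul, cubeNorm_smul, cubeNorm_horiz, cubeNorm_horiz, hM] at hc
  have hc' := mul_right_cancel₀ h0.ne' hc
  rw [abs_mul, abs_mul, abs_div, abs_div, abs_norm, abs_norm] at hc'
  have hc'' := mul_left_cancel₀ (abs_ne_zero.2 he) hc'
  rw [div_eq_div_iff hx0 hy0] at hc''
  have hnn := mul_left_cancel₀ (abs_ne_zero.2 hsin) hc''
  rw [hnn] at hH
  exact smul_right_injective _ (mul_ne_zero he (div_ne_zero hsin hx0)) hH

/-- The preimage has horizontal direction that of y, size M = arccos(yₙ / ‖y‖) and height log ‖y‖.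
The value of M is recorded because it decides whether the point lies in the open cell or on a face.
-/
lemma exists_zorichBase_eq (hn : 3 ≤ n) {y : EuclideanSpace ℝ (Fin n)} (hy : y ≠ 0)
    (hlast : 0 ≤ y (idxLast hn)) :
    ∃ x, cubeNorm hn x = Real.arccos (y (idxLast hn) / ‖y‖) ∧ zorichBase hn x = y := by
  have hy0 := norm_pos_iff.2 hy
  set M := Real.arccos (y (idxLast hn) / ‖y‖) with hM
  have hM0 : 0 ≤ M := Real.arccos_nonneg _
  have habs := abs_apply_le_norm y (idxLast hn)
  rw [abs_of_nonneg hlast] at habs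
  have hcos : Real.cos M = y (idxLast hn) / ‖y‖ :=
    Real.cos_arccos (by linarith [div_nonneg hlast hy0.le]) (div_le_one_of_le₀ habs hy0.le)
  have hsq := norm_sq_eq_horiz hn y
  set x := (M / cubeNorm hn y) • horiz hn y + Real.log ‖y‖ • axis hn with hx
  have hHx : horiz hn x = (M / cubeNorm hn y) • horiz hn y := by
    rw [hx, map_add, map_smul, map_smul, horiz_axis, horiz_horiz, smul_zero, add_zero]
  have hxl : x (idxLast hn) = Real.log ‖y‖ := by simp [hx]
  rcases eq_or_ne (horiz hn y) 0 with h | h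
  · have hyl : y (idxLast hn) = ‖y‖ := by
      rw [h, norm_zero] at hsq
      exact ((sq_eq_sq₀ hy0.le hlast).1 (by linarith)).symm
    have hM' : M = 0 := by rw [hM, hyl, div_self hy0.ne', Real.arccos_one]
    have hcx : cubeNorm hn x = 0 := by rw [cubeNorm_eq_zero_iff, hHx, h, smul_zero]
    refine ⟨x, hcx.trans hM'.symm, ?_⟩
    rw [zorichBase_eq, hHx, h, hcx, hxl, Real.exp_log hy0, Real.cos_zero]
    conv_rhs => rw [eq_horiz_add hn y, h, hyl]
    simp
  · have hc0 : cubeNorm hn y ≠ 0 := fun h' => h ((cubeNorm_eq_zero_iff hn y).1 h')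
    have hcx : cubeNorm hn x = M := by
      rw [← cubeNorm_horiz, hHx, cubeNorm_smul, cubeNorm_horiz,
        abs_of_nonneg (div_nonneg hM0 (cubeNorm_nonneg hn y)), div_mul_cancel₀ _ hc0]
    have hHn := norm_pos_iff.2 h
    have hsin : Real.sin M = ‖horiz hn y‖ / ‖y‖ := by
      rw [hM, Real.sin_arccos, Real.sqrt_eq_iff_mul_self_eq_of_pos (by positivity)]
      field_simp
      linarith
    have hMne : M ≠ 0 := by
      intro h'
      rw [h', Real.sin_zero] at hsin
      exact (div_pos hHn hy0).ne hsin
    refine ⟨x, hcx, ext_horiz hn ?_ ?_⟩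
    · rw [horiz_zorichBase, hcx, hxl, Real.exp_log hy0, hHx, norm_smul, norm_div, Real.norm_eq_abs,
        Real.norm_eq_abs, abs_of_nonneg hM0, abs_of_nonneg (cubeNorm_nonneg hn y), hsin, smul_smul]
      have : ‖y‖ * (‖horiz hn y‖ / ‖y‖ / (M / cubeNorm hn y * ‖horiz hn y‖)) *
          (M / cubeNorm hn y) = 1 := by field_simp
      rw [this, one_smul]
    · rw [zorichBase_last, hcx, hxl, Real.exp_log hy0, hcos]
      field_simp

lemma fold_eq_self (hn : 3 ≤ n) {x : EuclideanSpace ℝ (Fin n)} (hx : x ∈ closedCell hn) :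
    fold hn x = x := by
  ext i
  simp only [fold]
  split_ifs with hi
  · rfl
  · exact foldReal_of_abs_le (hx i hi)

/-- On a face the parity sign may be -1, because π/2 counts in the next cell; this is harmless since
the last coordinate contains cos(π/2) = 0. -/
lemma zorichMap_of_mem_closedCell (hn : 3 ≤ n) {x : EuclideanSpace ℝ (Fin n)}
    (hx : x ∈ closedCell hn) : zorichMap hn x = zorichBase hn x := by
  ext i
  simp only [zorichMap, fold_eq_self hn hx]
  split_ifs with hi
  · subst hi
    rcases ((mem_closedCell_iff hn).1 hx).lt_or_eq with h | h
    · have : foldSign hn x = 1 := by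
        refine Finset.prod_eq_one fun i hi => ?_
        rw [cellIndex_of_abs_lt ((mem_openCell_iff hn).2 h i (Finset.ne_of_mem_erase hi)),
          zpow_zero]
      rw [this, one_mul]
    · rw [zorichBase_last, h, Real.cos_pi_div_two, mul_zero, mul_zero]
  · rfl

/-- The reflection in the face `x₁ = π/2`. -/
def reflectFace (hn : 3 ≤ n) (x : EuclideanSpace ℝ (Fin n)) : EuclideanSpace ℝ (Fin n) :=
  WithLp.toLp 2 fun i => if i = idx₁ hn then Real.pi - x i else x i

/-- The reflection `yₙ ↦ -yₙ`. -/
def reflectLast (hn : 3 ≤ n) (x : EuclideanSpace ℝ (Fin n)) : EuclideanSpace ℝ (Fin n) :=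
  WithLp.toLp 2 fun i => if i = idxLast hn then - x i else x i

lemma reflectFace_reflectFace (hn : 3 ≤ n) (x : EuclideanSpace ℝ (Fin n)) :
    reflectFace hn (reflectFace hn x) = x := by
  ext i
  simp only [reflectFace]
  split_ifs <;> ring

lemma reflectLast_reflectLast (hn : 3 ≤ n) (x : EuclideanSpace ℝ (Fin n)) :
    reflectLast hn (reflectLast hn x) = x := by
  ext i
  simp only [reflectLast]
  split_ifs <;> ring

lemma reflectFace_mem_openCell_iff (hn : 3 ≤ n) {x : EuclideanSpace ℝ (Fin n)} :
    reflectFace hn x ∈ openCell hn ↔ x ∈ openCell' hn := by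
  constructor
  · intro h
    refine ⟨?_, fun i hi hi' => ?_⟩
    · have := h _ (idx₁_ne_idxLast hn)
      simp only [reflectFace, if_true] at this
      rwa [abs_sub_comm]
    · have := h i hi
      simpa only [reflectFace, if_neg hi'] using this
  · intro h i hi
    simp only [reflectFace]
    split_ifs with hi'
    · subst hi'; rw [abs_sub_comm]; exact h.1
    · exact h.2 i hi hi'

lemma reflectFace_mem_openCell'_iff (hn : 3 ≤ n) {x : EuclideanSpace ℝ (Fin n)} :
    reflectFace hn x ∈ openCell' hn ↔ x ∈ openCell hn := by
  rw [← reflectFace_mem_openCell_iff, reflectFace_reflectFace]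

lemma zorichMap_of_mem_openCell' (hn : 3 ≤ n) {x : EuclideanSpace ℝ (Fin n)}
    (hx : x ∈ openCell' hn) :
    zorichMap hn x = reflectLast hn (zorichBase hn (reflectFace hn x)) := by
  have hfold : fold hn x = reflectFace hn x := by
    ext i
    simp only [fold, reflectFace]
    by_cases hi : i = idxLast hn
    · rw [if_pos hi, if_neg (hi ▸ (idx₁_ne_idxLast hn).symm)]
    rw [if_neg hi]
    split_ifs with hi'
    · subst hi'; exact foldReal_of_abs_sub_pi_lt hx.1
    · exact foldReal_of_abs_le (hx.2 i hi hi').le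
  have hsign : foldSign hn x = -1 := by
    rw [foldSign, ← Finset.mul_prod_erase _ _
      (Finset.mem_erase.2 ⟨idx₁_ne_idxLast hn, Finset.mem_univ (idx₁ hn)⟩),
      cellIndex_of_abs_sub_pi_lt hx.1, Finset.prod_eq_one, zpow_one, mul_one]
    intro i hi
    simp only [Finset.mem_erase, Finset.mem_univ, and_true] at hi
    rw [cellIndex_of_abs_lt (hx.2 i hi.2 hi.1), zpow_zero]
  ext i
  simp only [zorichMap, reflectLast, hfold, hsign, neg_one_mul]

lemma zorichMap_last_nonneg (hn : 3 ≤ n) {x : EuclideanSpace ℝ (Fin n)}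
    (hx : x ∈ closedCell hn) : 0 ≤ zorichMap hn x (idxLast hn) := by
  rw [zorichMap_of_mem_closedCell hn hx, zorichBase_last]
  have := Real.cos_nonneg_of_neg_pi_div_two_le_of_le
    (by linarith [cubeNorm_nonneg hn x, Real.pi_pos]) ((mem_closedCell_iff hn).1 hx)
  positivity

lemma zorichMap_last_neg (hn : 3 ≤ n) {x : EuclideanSpace ℝ (Fin n)}
    (hx : x ∈ openCell' hn) : zorichMap hn x (idxLast hn) < 0 := by
  have hx' := (mem_openCell_iff hn).1 ((reflectFace_mem_openCell_iff hn).2 hx)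
  have := Real.cos_pos_of_mem_Ioo
    ⟨by linarith [cubeNorm_nonneg hn (reflectFace hn x), Real.pi_pos], hx'⟩
  rw [zorichMap_of_mem_openCell' hn hx, reflectLast]
  simp only [if_true, zorichBase_last]
  have h := mul_pos (Real.exp_pos (reflectFace hn x (idxLast hn))) this
  linarith

/-- The closed cell covers the half-space yₙ ≥ 0 without the origin and the other cell covers yₙ <
0. The sign of yₙ separates the two, and within each cell the base map or its mirror image applies.
-/
lemma zorichMap_bijOn (hn : 3 ≤ n) : Set.BijOn (zorichMap hn) (fundamentalSet hn) {0}ᶜ := by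
  have hpos : ∀ x, zorichBase hn x ≠ 0 := fun x h => by
    have := norm_zorichBase hn x
    rw [h, norm_zero] at this
    exact (Real.exp_pos _).ne this
  refine ⟨?_, ?_, ?_⟩
  · rintro x (hx | hx)
    · rw [zorichMap_of_mem_closedCell hn hx]
      exact hpos x
    · intro h
      have := zorichMap_last_neg hn hx
      rw [Set.mem_singleton_iff.1 h] at this
      simp at this
  · rintro x (hx | hx) y (hy | hy) hxy
    · rw [zorichMap_of_mem_closedCell hn hx, zorichMap_of_mem_closedCell hn hy] at hxy
      exact zorichBase_injOn hn hx hy hxy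
    · have h1 := zorichMap_last_nonneg hn hx
      have h2 := zorichMap_last_neg hn hy
      rw [hxy] at h1; linarith
    · have h1 := zorichMap_last_nonneg hn hy
      have h2 := zorichMap_last_neg hn hx
      rw [hxy] at h2; linarith
    · rw [zorichMap_of_mem_openCell' hn hx, zorichMap_of_mem_openCell' hn hy] at hxy
      have h1 := congrArg (reflectLast hn) hxy
      rw [reflectLast_reflectLast, reflectLast_reflectLast] at h1
      have h2 := zorichBase_injOn hn
        (openCell_subset_closedCell hn ((reflectFace_mem_openCell_iff hn).2 hx))
        (openCell_subset_closedCell hn ((reflectFace_mem_openCell_iff hn).2 hy)) h1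
      have h3 := congrArg (reflectFace hn) h2
      rwa [reflectFace_reflectFace, reflectFace_reflectFace] at h3
  · intro y hy
    rcases le_or_gt 0 (y (idxLast hn)) with h | h
    · obtain ⟨x, hx, hxy⟩ := exists_zorichBase_eq hn hy h
      have hxc : x ∈ closedCell hn := by
        rw [mem_closedCell_iff, hx, Real.arccos_le_pi_div_two]
        positivity
      exact ⟨x, Or.inl hxc, by rw [zorichMap_of_mem_closedCell hn hxc, hxy]⟩
    · have hy' : reflectLast hn y ≠ 0 := fun h0 => by
        rw [← reflectLast_reflectLast hn y, h0] at h
        simp [reflectLast] at h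
      have hl : 0 < reflectLast hn y (idxLast hn) := by
        simp only [reflectLast, if_true]; linarith
      obtain ⟨x, hx, hxy⟩ := exists_zorichBase_eq hn hy' hl.le
      have hxc : x ∈ openCell hn := by
        rw [mem_openCell_iff, hx, Real.arccos_lt_pi_div_two]
        exact div_pos hl (norm_pos_iff.2 hy')
      have hxc' := (reflectFace_mem_openCell'_iff hn).2 hxc
      refine ⟨reflectFace hn x, Or.inr hxc', ?_⟩
      rw [zorichMap_of_mem_openCell' hn hxc', reflectFace_reflectFace, hxy,
        reflectLast_reflectLast]

/-! ### The Zorich transform -/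

lemma zorichTransform_bijOn (hn : 3 ≤ n)
    {f : EuclideanSpace ℝ (Fin n) → EuclideanSpace ℝ (Fin n)} (hf : Function.Bijective f)
    (hf0 : f 0 = 0) :
    Set.BijOn (zorichTransform hn f) (fundamentalSet hn) (fundamentalSet hn) := by
  have hZ := zorichMap_bijOn hn
  have hf' : Set.BijOn f {0}ᶜ {0}ᶜ := by
    refine ⟨fun x hx h => hx (hf.1 ?_), hf.1.injOn, fun y hy => ?_⟩
    · rw [hf0]; exact h
    · obtain ⟨x, rfl⟩ := hf.2 y
      refine ⟨x, fun h => hy ?_, rfl⟩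
      rw [Set.mem_singleton_iff] at h ⊢
      rw [h, hf0]
  have hinv : Set.BijOn (Function.invFunOn (zorichMap hn) (fundamentalSet hn)) {0}ᶜ
      (fundamentalSet hn) :=
    (Set.InvOn.symm hZ.invOn_invFunOn).bijOn hZ.surjOn.mapsTo_invFunOn hZ.mapsTo
  exact hinv.comp (hf'.comp hZ)

lemma zorichMap_zorichTransform (hn : 3 ≤ n)
    {f : EuclideanSpace ℝ (Fin n) → EuclideanSpace ℝ (Fin n)} (hf : Function.Injective f)
    (hf0 : f 0 = 0) {x : EuclideanSpace ℝ (Fin n)} (hx : x ∈ fundamentalSet hn) :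
    zorichMap hn (zorichTransform hn f x) = f (zorichMap hn x) := by
  have hZ := zorichMap_bijOn hn
  refine hZ.invOn_invFunOn.2 fun h => hZ.mapsTo hx (hf ?_)
  rw [hf0]; exact h

/-- Identifies the transform without inverting the Zorich map: a candidate in B that solves the
conjugacy equation is the value. -/
lemma zorichTransform_eq (hn : 3 ≤ n)
    {f : EuclideanSpace ℝ (Fin n) → EuclideanSpace ℝ (Fin n)} {x u : EuclideanSpace ℝ (Fin n)}
    (hu : u ∈ fundamentalSet hn) (h : zorichMap hn u = f (zorichMap hn x)) :
    zorichTransform hn f x = u := by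
  rw [zorichTransform, ← h]
  exact (zorichMap_bijOn hn).invOn_invFunOn.1 hu

/-- The first coordinate of the direction of `zorichBase x`. -/
def zorichDirection₁ (hn : 3 ≤ n) (x : EuclideanSpace ℝ (Fin n)) : ℝ :=
  Real.sin (cubeNorm hn x) / ‖horiz hn x‖ * x (idx₁ hn)

lemma direction₁_zorichBase (hn : 3 ≤ n) (x : EuclideanSpace ℝ (Fin n)) :
    direction₁ hn (zorichBase hn x) = zorichDirection₁ hn x := by
  have h := (Real.exp_pos (x (idxLast hn))).ne'
  rw [direction₁, norm_zorichBase, zorichBase_eq, zorichDirection₁]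
  simp [axis, idx₁_ne_idxLast, horiz_apply hn x (idx₁_ne_idxLast hn), h]

lemma abs_zorichDirection₁_le (hn : 3 ≤ n) (x : EuclideanSpace ℝ (Fin n)) :
    |zorichDirection₁ hn x| ≤ 1 := by
  rw [← direction₁_zorichBase]
  exact abs_direction₁_le hn _

/-- The horizontal part of `spiralFormula`. -/
def spiralHoriz (hn : 3 ≤ n) (θ : ℝ) (x : EuclideanSpace ℝ (Fin n)) : EuclideanSpace ℝ (Fin n) :=
  (cubeNorm hn x / cubeNorm hn (planeRotation hn θ x)) • planeRotation hn θ (horiz hn x)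

/-- The formula for the Zorich transform in vector form. -/
lemma spiralFormula_eq (hn : 3 ≤ n) {K : ℝ} (hK : 1 ≤ K) (α : ℝ) (x : EuclideanSpace ℝ (Fin n)) :
    spiralFormula hn K α x = spiralHoriz hn (α * x (idxLast hn)) x +
      (x (idxLast hn) + Real.log (stretchFactor K (zorichDirection₁ hn x))) • axis hn := by
  ext i
  simp only [spiralFormula, spiralHoriz, ← horiz_planeRotation, PiLp.add_apply, PiLp.smul_apply,
    smul_eq_mul]
  split_ifs with hi
  · subst hi
    rw [log_stretchFactor hK (abs_zorichDirection₁_le hn x), zorichDirection₁, horizNorm_eq_norm,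
      horiz_last, axis_last,
      show x (idx₁ hn) ^ 2 * Real.sin (cubeNorm hn x) ^ 2 / ‖horiz hn x‖ ^ 2 =
        (Real.sin (cubeNorm hn x) / ‖horiz hn x‖ * x (idx₁ hn)) ^ 2 by ring]
    ring
  · rw [horiz_apply hn _ hi]
    simp [axis, hi, div_eq_mul_inv]

lemma horiz_spiralHoriz (hn : 3 ≤ n) (θ : ℝ) (x : EuclideanSpace ℝ (Fin n)) :
    horiz hn (spiralHoriz hn θ x) = spiralHoriz hn θ x := by
  rw [spiralHoriz, map_smul, horiz_planeRotation, horiz_horiz]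

lemma cubeNorm_planeRotation_eq_zero_iff (hn : 3 ≤ n) (θ : ℝ) (x : EuclideanSpace ℝ (Fin n)) :
    cubeNorm hn (planeRotation hn θ x) = 0 ↔ cubeNorm hn x = 0 := by
  rw [cubeNorm_eq_zero_iff, cubeNorm_eq_zero_iff, horiz_planeRotation, ← norm_eq_zero,
    norm_planeRotation, norm_eq_zero]

/-- The factor M(x) / M(w) is there to make this true: the rotation would push points out of the
cube, and the rescaling brings them back to the same cube surface. -/
lemma cubeNorm_spiralHoriz (hn : 3 ≤ n) (θ : ℝ) (x : EuclideanSpace ℝ (Fin n)) :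
    cubeNorm hn (spiralHoriz hn θ x) = cubeNorm hn x := by
  rw [spiralHoriz, cubeNorm_smul, ← horiz_planeRotation, cubeNorm_horiz, abs_of_nonneg
    (div_nonneg (cubeNorm_nonneg hn x) (cubeNorm_nonneg hn _))]
  rcases eq_or_ne (cubeNorm hn x) 0 with h | h
  · rw [h, zero_div, zero_mul]
  · rw [div_mul_cancel₀]
    rwa [ne_eq, cubeNorm_planeRotation_eq_zero_iff]

lemma horiz_spiralFormula (hn : 3 ≤ n) {K : ℝ} (hK : 1 ≤ K) (α : ℝ)
    (x : EuclideanSpace ℝ (Fin n)) :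
    horiz hn (spiralFormula hn K α x) = spiralHoriz hn (α * x (idxLast hn)) x := by
  rw [spiralFormula_eq hn hK, map_add, map_smul, horiz_axis, smul_zero, add_zero,
    horiz_spiralHoriz]

lemma cubeNorm_spiralFormula (hn : 3 ≤ n) {K : ℝ} (hK : 1 ≤ K) (α : ℝ)
    (x : EuclideanSpace ℝ (Fin n)) : cubeNorm hn (spiralFormula hn K α x) = cubeNorm hn x := by
  rw [← cubeNorm_horiz, horiz_spiralFormula hn hK, cubeNorm_spiralHoriz]

lemma spiralFormula_last (hn : 3 ≤ n) {K : ℝ} (hK : 1 ≤ K) (α : ℝ)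
    (x : EuclideanSpace ℝ (Fin n)) : spiralFormula hn K α x (idxLast hn) =
      x (idxLast hn) + Real.log (stretchFactor K (zorichDirection₁ hn x)) := by
  rw [spiralFormula_eq hn hK, PiLp.add_apply, ← horiz_spiralHoriz, horiz_last]
  simp

lemma zorichBase_spiralFormula (hn : 3 ≤ n) {K : ℝ} (hK : 1 ≤ K) (α : ℝ)
    (x : EuclideanSpace ℝ (Fin n)) :
    zorichBase hn (spiralFormula hn K α x) = spiralStretch hn K α (zorichBase hn x) := by
  have hpos : 0 < stretchFactor K (zorichDirection₁ hn x) := by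
    linarith [one_le_stretchFactor hK (abs_zorichDirection₁_le hn x)]
  -- The Zorich map sees only M and the unit horizontal direction, so the rescaling disappears and a
  -- pure rotation remains.
  have hrot : (Real.sin (cubeNorm hn x) / ‖spiralHoriz hn (α * x (idxLast hn)) x‖) •
      spiralHoriz hn (α * x (idxLast hn)) x = (Real.sin (cubeNorm hn x) / ‖horiz hn x‖) •
        planeRotation hn (α * x (idxLast hn)) (horiz hn x) := by
    rcases (cubeNorm_nonneg hn x).eq_or_lt with h | h
    · rw [← h]; simp
    · have h' : 0 < cubeNorm hn (planeRotation hn (α * x (idxLast hn)) x) :=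
        lt_of_le_of_ne (cubeNorm_nonneg hn _) fun h0 =>
          h.ne' ((cubeNorm_planeRotation_eq_zero_iff hn _ x).1 h0.symm)
      have hx0 : ‖horiz hn x‖ ≠ 0 := by
        rw [norm_ne_zero_iff, ne_eq, ← cubeNorm_eq_zero_iff]; exact h.ne'
      rw [spiralHoriz, norm_smul, norm_planeRotation, smul_smul, Real.norm_eq_abs,
        abs_of_pos (by positivity)]
      congr 1
      field_simp
  rw [spiralStretch_eq, direction₁_zorichBase, norm_zorichBase, Real.log_exp, zorichBase_eq,
    spiralFormula_last hn hK, horiz_spiralFormula hn hK, cubeNorm_spiralFormula hn hK, hrot,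
    zorichBase_eq, planeRotation_smul, planeRotation_add, planeRotation_smul, planeRotation_smul,
    planeRotation_axis, smul_smul, Real.exp_add, Real.exp_log hpos, mul_comm]

lemma zorichTransform_spiralStretch (hn : 3 ≤ n) {K : ℝ} (hK : 1 ≤ K) (α : ℝ)
    {x : EuclideanSpace ℝ (Fin n)} (hx : x ∈ closedCell hn) :
    zorichTransform hn (spiralStretch hn K α) x = spiralFormula hn K α x := by
  have h : spiralFormula hn K α x ∈ closedCell hn := by
    rwa [mem_closedCell_iff, cubeNorm_spiralFormula hn hK, ← mem_closedCell_iff]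
  refine zorichTransform_eq hn (Or.inl h) ?_
  rw [zorichMap_of_mem_closedCell hn hx, zorichMap_of_mem_closedCell hn h,
    zorichBase_spiralFormula hn hK]

lemma norm_reflectLast (hn : 3 ≤ n) (x : EuclideanSpace ℝ (Fin n)) :
    ‖reflectLast hn x‖ = ‖x‖ := by
  rw [EuclideanSpace.norm_eq, EuclideanSpace.norm_eq]
  congr 1
  refine Finset.sum_congr rfl fun i _ => ?_
  simp only [reflectLast]
  split_ifs
  · rw [norm_neg]
  · rfl

/-- The norm, the first coordinate and the rotation plane do not see the sign of yₙ. This symmetry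
carries the formula from the closed cell to the second cell. -/
lemma spiralStretch_reflectLast (hn : 3 ≤ n) (K α : ℝ) (x : EuclideanSpace ℝ (Fin n)) :
    spiralStretch hn K α (reflectLast hn x) = reflectLast hn (spiralStretch hn K α x) := by
  have h1 := idx₁_ne_idxLast hn
  have h2 := idx₂_ne_idxLast hn
  have h12 := idx₁_ne_idx₂ hn
  rw [spiralStretch, spiralStretch, norm_reflectLast]
  refine ext_idx hn ?_ ?_ fun i hi₁ hi₂ => ?_
  · simp [reflectLast, planeRotation_idx₁, h1, h2]
  · simp [reflectLast, planeRotation_idx₂, h1, h2]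
  · by_cases hi : i = idxLast hn
    · subst hi
      simp [reflectLast, h1]
    · simp [reflectLast, planeRotation_of_ne hn _ _ hi₁ hi₂, h1, hi]

lemma zorichTransform_spiralStretch_of_mem_openCell' (hn : 3 ≤ n) {K : ℝ} (hK : 1 ≤ K) (α : ℝ)
    {x : EuclideanSpace ℝ (Fin n)} (hx : x ∈ openCell' hn) :
    zorichTransform hn (spiralStretch hn K α) x =
      reflectFace hn (spiralFormula hn K α (reflectFace hn x)) := by
  have h : spiralFormula hn K α (reflectFace hn x) ∈ openCell hn := by
    rwa [mem_openCell_iff, cubeNorm_spiralFormula hn hK, ← mem_openCell_iff,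
      reflectFace_mem_openCell_iff]
  have h' := (reflectFace_mem_openCell'_iff hn).2 h
  refine zorichTransform_eq hn (Or.inr h') ?_
  rw [zorichMap_of_mem_openCell' hn h', zorichMap_of_mem_openCell' hn hx, reflectFace_reflectFace,
    zorichBase_spiralFormula hn hK, spiralStretch_reflectLast]

/-! ### Lipschitz bounds for the explicit formula -/

lemma norm_rotation_horiz_sub_le (hn : 3 ≤ n) (θ φ : ℝ) (x y : EuclideanSpace ℝ (Fin n)) :
    ‖planeRotation hn θ (horiz hn x) - planeRotation hn φ (horiz hn y)‖ ≤
      ‖x - y‖ + 2 * |θ - φ| * ‖horiz hn y‖ := by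
  have e : planeRotation hn θ (horiz hn x) - planeRotation hn φ (horiz hn y) =
      planeRotation hn θ (horiz hn (x - y)) +
        (planeRotation hn θ (horiz hn y) - planeRotation hn φ (horiz hn y)) := by
    rw [map_sub, planeRotation_sub]; abel
  rw [e]
  refine (norm_add_le _ _).trans (add_le_add ?_ (norm_planeRotation_sub_le hn θ φ _))
  rw [norm_planeRotation]
  exact norm_horiz_le hn _

/-- An instance of `norm_rescale_sub_le` with A = 2 (rounding up √2) and D = n. Keeping the angles
independent gives the Lipschitz bound and, for x = y, also the effect of changing the angle alone.
-/
lemma norm_spiralHoriz_sub_le (hn : 3 ≤ n) (θ φ : ℝ) (x y : EuclideanSpace ℝ (Fin n)) :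
    ‖spiralHoriz hn θ x - spiralHoriz hn φ y‖ ≤
      (3 * n + 2) * ‖x - y‖ + 4 * (n + 1) * |θ - φ| * ‖horiz hn y‖ := by
  have hs : √2 ≤ 2 := by rw [Real.sqrt_le_left (by norm_num)]; norm_num
  have hsize : ∀ (θ : ℝ) (x : EuclideanSpace ℝ (Fin n)),
      |cubeNorm hn x| ≤ 2 * cubeNorm hn (planeRotation hn θ x) := fun θ x => by
    rw [abs_of_nonneg (cubeNorm_nonneg hn x)]
    refine (cubeNorm_le_planeRotation hn θ x).trans ?_
    gcongr
    exact cubeNorm_nonneg hn _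
  have hcomp : ∀ (θ : ℝ) (x : EuclideanSpace ℝ (Fin n)),
      ‖planeRotation hn θ (horiz hn x)‖ ≤ n * cubeNorm hn (planeRotation hn θ x) := fun θ x => by
    rw [← horiz_planeRotation]
    exact norm_horiz_le_mul_cubeNorm hn _
  have key := norm_rescale_sub_le (cubeNorm_nonneg hn (planeRotation hn θ x))
    (cubeNorm_nonneg hn (planeRotation hn φ y)) (hcomp θ x) (hcomp φ y) (hsize θ x) (hsize φ y)
    zero_le_two (Nat.cast_nonneg n)
  refine key.trans ?_
  have h1 : |cubeNorm hn x - cubeNorm hn y| ≤ ‖x - y‖ := by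
    refine (abs_cubeNorm_sub_le hn x y).trans ?_
    rw [← map_sub]
    exact norm_horiz_le hn _
  have h2 := abs_cubeNorm_sub_le hn (planeRotation hn θ x) (planeRotation hn φ y)
  rw [horiz_planeRotation, horiz_planeRotation] at h2
  have h3 := norm_rotation_horiz_sub_le hn θ φ x y
  set d := ‖planeRotation hn θ (horiz hn x) - planeRotation hn φ (horiz hn y)‖
  calc n * |cubeNorm hn x - cubeNorm hn y| + 2 * (d + n * |_|)
      ≤ n * ‖x - y‖ + 2 * (d + n * d) := by gcongr
    _ = n * ‖x - y‖ + 2 * (n + 1) * d := by ring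
    _ ≤ n * ‖x - y‖ + 2 * (n + 1) * (‖x - y‖ + 2 * |θ - φ| * ‖horiz hn y‖) := by gcongr
    _ = _ := by ring

lemma abs_zorichDirection₁_sub_le (hn : 3 ≤ n) (x y : EuclideanSpace ℝ (Fin n)) :
    |zorichDirection₁ hn x - zorichDirection₁ hn y| ≤ 3 * ‖x - y‖ := by
  have hsin : ∀ x : EuclideanSpace ℝ (Fin n), |Real.sin (cubeNorm hn x)| ≤ 1 * ‖horiz hn x‖ :=
    fun x => by
      rw [one_mul]
      refine Real.abs_sin_le_abs.trans ?_
      rw [abs_of_nonneg (cubeNorm_nonneg hn x)]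
      exact cubeNorm_le_norm_horiz hn x
  have key := norm_rescale_sub_le (norm_nonneg (horiz hn x)) (norm_nonneg (horiz hn y))
    (one_mul ‖horiz hn x‖).ge (one_mul ‖horiz hn y‖).ge (hsin x) (hsin y) zero_le_one zero_le_one
  have e : zorichDirection₁ hn x - zorichDirection₁ hn y =
      ((Real.sin (cubeNorm hn x) / ‖horiz hn x‖) • horiz hn x -
        (Real.sin (cubeNorm hn y) / ‖horiz hn y‖) • horiz hn y) (idx₁ hn) := by
    simp [zorichDirection₁, horiz_apply hn _ (idx₁_ne_idxLast hn)]
  rw [e]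
  refine (abs_apply_le_norm _ _).trans (key.trans ?_)
  have h0 : ‖horiz hn x - horiz hn y‖ ≤ ‖x - y‖ := by
    rw [← map_sub]
    exact norm_horiz_le hn _
  have h1 := (Real.abs_sin_sub_sin_le (cubeNorm hn x) (cubeNorm hn y)).trans
    (abs_cubeNorm_sub_le hn x y)
  have h2 := abs_norm_sub_norm_le (horiz hn x) (horiz hn y)
  linarith

/-- A Lipschitz constant of the explicit formula on the closed cell. -/
def formulaLip (n : ℕ) (K : ℝ) : ℝ := (3 * n + 2) + 8 * n * (n + 1) + (1 + 3 * K ^ 3)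

lemma formulaLip_pos (n : ℕ) {K : ℝ} (hK : 1 ≤ K) : 0 < formulaLip n K := by
  unfold formulaLip; positivity

lemma norm_horiz_le_of_mem_closedCell (hn : 3 ≤ n) {x : EuclideanSpace ℝ (Fin n)}
    (hx : x ∈ closedCell hn) : ‖horiz hn x‖ ≤ 2 * n := by
  have h1 := norm_horiz_le_mul_cubeNorm hn x
  have h2 := (mem_closedCell_iff hn).1 hx
  have h3 := Real.pi_lt_four
  have : (0 : ℝ) ≤ n := Nat.cast_nonneg n
  nlinarith

lemma lipschitzOnWith_spiralFormula (hn : 3 ≤ n) {K α : ℝ} (hK : 1 ≤ K) (hα : |α| ≤ 1) :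
    LipschitzOnWith (formulaLip n K).toNNReal (spiralFormula hn K α) (closedCell hn) := by
  refine LipschitzOnWith.of_dist_le_mul fun x hx y hy => ?_
  rw [dist_eq_norm, dist_eq_norm, Real.coe_toNNReal _ (formulaLip_pos n hK).le,
    spiralFormula_eq hn hK, spiralFormula_eq hn hK, add_sub_add_comm, ← sub_smul]
  refine (norm_add_le _ _).trans ?_
  have hlast : |x (idxLast hn) - y (idxLast hn)| ≤ ‖x - y‖ := abs_apply_le_norm (x - y) _
  have h1 := norm_spiralHoriz_sub_le hn (α * x (idxLast hn)) (α * y (idxLast hn)) x y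
  have h2 : 4 * (n + 1) * |α * x (idxLast hn) - α * y (idxLast hn)| * ‖horiz hn y‖ ≤
      8 * n * (n + 1) * ‖x - y‖ := by
    rw [← mul_sub, abs_mul]
    calc 4 * (n + 1) * (|α| * |x (idxLast hn) - y (idxLast hn)|) * ‖horiz hn y‖
        ≤ 4 * (n + 1) * (1 * ‖x - y‖) * (2 * n) := by
          gcongr
          exact norm_horiz_le_of_mem_closedCell hn hy
      _ = _ := by ring
  have h3 := abs_log_stretchFactor_sub_le hK (abs_zorichDirection₁_le hn x)
    (abs_zorichDirection₁_le hn y)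
  have h4 : K ^ 3 * |zorichDirection₁ hn x - zorichDirection₁ hn y| ≤ K ^ 3 * (3 * ‖x - y‖) := by
    gcongr
    exact abs_zorichDirection₁_sub_le hn x y
  have h5 : ‖axis hn‖ = 1 := by simp [axis]
  rw [norm_smul, h5, mul_one, Real.norm_eq_abs, add_sub_add_comm]
  have h6 := abs_add_le (x (idxLast hn) - y (idxLast hn))
    (Real.log (stretchFactor K (zorichDirection₁ hn x)) -
      Real.log (stretchFactor K (zorichDirection₁ hn y)))
  rw [formulaLip]
  linarith

/-! ### The Jacobian of the explicit formula -/

open Filter Topology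

/-- The points whose horizontal coordinates have distinct absolute values. -/
def distinctAbs (hn : 3 ≤ n) : Set (EuclideanSpace ℝ (Fin n)) :=
  {x | ∀ i j, i ≠ idxLast hn → j ≠ idxLast hn → i ≠ j → |x i| ≠ |x j|}

lemma cubeNorm_pos_of_mem_distinctAbs (hn : 3 ≤ n) {x : EuclideanSpace ℝ (Fin n)}
    (hx : x ∈ distinctAbs hn) : 0 < cubeNorm hn x := by
  refine lt_of_le_of_ne (cubeNorm_nonneg hn x) fun h => ?_
  have h0 : ∀ i, i ≠ idxLast hn → |x i| = 0 := fun i hi =>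
    le_antisymm (h ▸ abs_le_cubeNorm hn x hi) (abs_nonneg _)
  exact hx _ _ (idx₁_ne_idxLast hn) (idx₂_ne_idxLast hn) (idx₁_ne_idx₂ hn)
    ((h0 _ (idx₁_ne_idxLast hn)).trans (h0 _ (idx₂_ne_idxLast hn)).symm)

/-- Without ties a single coordinate strictly dominates near x, and it is nonzero, so M is locally
its absolute value. -/
lemma differentiableAt_cubeNorm (hn : 3 ≤ n) {x : EuclideanSpace ℝ (Fin n)}
    (hx : x ∈ distinctAbs hn) : DifferentiableAt ℝ (cubeNorm hn) x := by
  obtain ⟨i, hi, hix⟩ := exists_abs_eq_cubeNorm hn x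
  have hxi : x i ≠ 0 := by
    rw [← abs_pos, hix]
    exact cubeNorm_pos_of_mem_distinctAbs hn hx
  have hc : ∀ j, Continuous fun y : EuclideanSpace ℝ (Fin n) => |y j| := fun j => by fun_prop
  have hev : cubeNorm hn =ᶠ[𝓝 x] fun y => |y i| := by
    have : ∀ᶠ y in 𝓝 x, ∀ j, j ≠ idxLast hn → |y j| ≤ |y i| := by
      refine eventually_all.2 fun j => ?_
      by_cases hj : j = idxLast hn
      · exact Eventually.of_forall fun y h => absurd hj h
      by_cases hji : j = i
      · exact Eventually.of_forall fun y _ => by rw [hji]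
      have hlt : |x j| < |x i| :=
        lt_of_le_of_ne (hix ▸ abs_le_cubeNorm hn x hj) (hx j i hj hi hji)
      filter_upwards [(hc j).continuousAt.eventually_lt (hc i).continuousAt hlt] with y hy _
      exact hy.le
    filter_upwards [this] with y hy
    exact le_antisymm ((cubeNorm_le_iff hn).2 hy) (abs_le_cubeNorm hn y hi)
  refine DifferentiableAt.congr_of_eventuallyEq ?_ hev
  have h1 : DifferentiableAt ℝ (fun y : EuclideanSpace ℝ (Fin n) => y i) x :=
    (EuclideanSpace.proj (𝕜 := ℝ) i).differentiableAt
  exact h1.abs hxi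

lemma horiz_ne_zero_of_mem_distinctAbs (hn : 3 ≤ n) {x : EuclideanSpace ℝ (Fin n)}
    (hx : x ∈ distinctAbs hn) : horiz hn x ≠ 0 := by
  rw [ne_eq, ← cubeNorm_eq_zero_iff]
  exact (cubeNorm_pos_of_mem_distinctAbs hn hx).ne'

lemma differentiableAt_log_stretchFactor (hn : 3 ≤ n) {K : ℝ} (hK : 1 ≤ K)
    {x : EuclideanSpace ℝ (Fin n)} (hx : x ∈ distinctAbs hn) :
    DifferentiableAt ℝ (fun y => Real.log (stretchFactor K (zorichDirection₁ hn y))) x := by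
  have hM := differentiableAt_cubeNorm hn hx
  have hH := horiz_ne_zero_of_mem_distinctAbs hn hx
  have h1 : DifferentiableAt ℝ (fun y : EuclideanSpace ℝ (Fin n) => y (idx₁ hn)) x :=
    (EuclideanSpace.proj (𝕜 := ℝ) (idx₁ hn)).differentiableAt
  have h2 : DifferentiableAt ℝ (fun y => ‖horiz hn y‖) x := (horiz hn).differentiableAt.norm ℝ hH
  have h3 : DifferentiableAt ℝ (zorichDirection₁ hn) x := by
    change DifferentiableAt ℝ
      (fun y => Real.sin (cubeNorm hn y) / ‖horiz hn y‖ * y (idx₁ hn)) x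
    simp only [div_eq_mul_inv]
    exact (hM.sin.fun_mul (h2.fun_inv (norm_ne_zero_iff.2 hH))).fun_mul h1
  have h4 : DifferentiableAt ℝ (fun y => stretchFactor K (zorichDirection₁ hn y)) x :=
    (differentiableAt_stretchFactor hK (abs_zorichDirection₁_le hn x)).comp x h3
  exact h4.log (by linarith [one_le_stretchFactor hK (abs_zorichDirection₁_le hn x)])

/-- The map obtained from `spiralFormula` by fixing the angle of the rotation. -/
def frozenFormula (hn : 3 ≤ n) (K θ : ℝ) (x : EuclideanSpace ℝ (Fin n)) :
    EuclideanSpace ℝ (Fin n) :=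
  spiralHoriz hn θ x +
    (x (idxLast hn) + Real.log (stretchFactor K (zorichDirection₁ hn x))) • axis hn

/-- The angle is an arbitrary differentiable function, so that the true angle αxₙ and the frozen
constant angle are both covered. -/
lemma differentiableAt_spiralHoriz (hn : 3 ≤ n) {x : EuclideanSpace ℝ (Fin n)}
    {θ : EuclideanSpace ℝ (Fin n) → ℝ} (hθ : DifferentiableAt ℝ θ x) (hx : x ∈ distinctAbs hn)
    (hw : planeRotation hn (θ x) x ∈ distinctAbs hn) :
    DifferentiableAt ℝ (fun y => cubeNorm hn y / cubeNorm hn (planeRotation hn (θ y) y)) x ∧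
      DifferentiableAt ℝ (fun y => spiralHoriz hn (θ y) y) x := by
  have hrot : DifferentiableAt ℝ (fun y => planeRotation hn (θ y) y) x :=
    ((contDiff_planeRotation hn (k := 1)).differentiable one_ne_zero (θ x, x)).comp
      (f := fun y => (θ y, y)) x (hθ.prodMk differentiableAt_fun_id)
  have h1 : DifferentiableAt ℝ (fun y => cubeNorm hn (planeRotation hn (θ y) y)) x :=
    (differentiableAt_cubeNorm hn hw).comp (f := fun y => planeRotation hn (θ y) y) x hrot
  have h2 : DifferentiableAt ℝ
      (fun y => cubeNorm hn y / cubeNorm hn (planeRotation hn (θ y) y)) x := by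
    simp only [div_eq_mul_inv]
    exact (differentiableAt_cubeNorm hn hx).fun_mul
      (h1.fun_inv (cubeNorm_pos_of_mem_distinctAbs hn hw).ne')
  refine ⟨h2, ?_⟩
  have h3 : DifferentiableAt ℝ (fun y => planeRotation hn (θ y) (horiz hn y)) x := by
    simp only [← horiz_planeRotation]
    exact (horiz hn).differentiableAt.comp x hrot
  exact h2.fun_smul h3

lemma differentiableAt_last (hn : 3 ≤ n) (x : EuclideanSpace ℝ (Fin n)) :
    DifferentiableAt ℝ (fun y : EuclideanSpace ℝ (Fin n) => y (idxLast hn)) x :=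
  (EuclideanSpace.proj (𝕜 := ℝ) (idxLast hn)).differentiableAt

lemma differentiableAt_vertical (hn : 3 ≤ n) {K : ℝ} (hK : 1 ≤ K)
    {x : EuclideanSpace ℝ (Fin n)} (hx : x ∈ distinctAbs hn) :
    DifferentiableAt ℝ (fun y => (y (idxLast hn) +
      Real.log (stretchFactor K (zorichDirection₁ hn y))) • axis hn) x :=
  ((differentiableAt_last hn x).fun_add
    (differentiableAt_log_stretchFactor hn hK hx)).smul_const (axis hn)

lemma differentiableAt_spiralFormula (hn : 3 ≤ n) {K : ℝ} (hK : 1 ≤ K) (α : ℝ)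
    {x : EuclideanSpace ℝ (Fin n)} (hx : x ∈ distinctAbs hn)
    (hw : planeRotation hn (α * x (idxLast hn)) x ∈ distinctAbs hn) :
    DifferentiableAt ℝ (spiralFormula hn K α) x := by
  have h1 := (differentiableAt_spiralHoriz hn (θ := fun y => α * y (idxLast hn))
    ((differentiableAt_last hn x).const_mul α) hx hw).2
  exact (h1.fun_add (differentiableAt_vertical hn hK hx)).congr_of_eventuallyEq
    (Eventually.of_forall fun y => spiralFormula_eq hn hK α y)

lemma zorichDirection₁_add_axis (hn : 3 ≤ n) (x : EuclideanSpace ℝ (Fin n)) (t : ℝ) :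
    zorichDirection₁ hn (x + t • axis hn) = zorichDirection₁ hn x := by
  have h : horiz hn (x + t • axis hn) = horiz hn x := by
    rw [map_add, map_smul, horiz_axis, smul_zero, add_zero]
  rw [zorichDirection₁, zorichDirection₁, ← cubeNorm_horiz, h, cubeNorm_horiz,
    ← horiz_apply hn (x + t • axis hn) (idx₁_ne_idxLast hn), h,
    horiz_apply hn _ (idx₁_ne_idxLast hn)]

/-- The determinant of the derivative of `frozenFormula`: the horizontal part is homogeneous of
degree one and expands by `M(x) / M(w)`. -/
lemma det_fderiv_frozenFormula (hn : 3 ≤ n) {K : ℝ} (hK : 1 ≤ K) (θ : ℝ)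
    {x : EuclideanSpace ℝ (Fin n)} (hx : x ∈ distinctAbs hn)
    (hw : planeRotation hn θ x ∈ distinctAbs hn) :
    DifferentiableAt ℝ (frozenFormula hn K θ) x ∧
      (fderiv ℝ (frozenFormula hn K θ) x).det =
        (cubeNorm hn x / cubeNorm hn (planeRotation hn θ x)) ^ (n - 1) := by
  obtain ⟨hl, -⟩ := differentiableAt_spiralHoriz hn (θ := fun _ => θ)
    (differentiableAt_const θ) hx hw
  have hq := differentiableAt_log_stretchFactor hn hK hx
  set lam : EuclideanSpace ℝ (Fin n) → ℝ :=
    fun y => cubeNorm hn y / cubeNorm hn (planeRotation hn θ y) with hlam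
  set q : EuclideanSpace ℝ (Fin n) → ℝ :=
    fun y => Real.log (stretchFactor K (zorichDirection₁ hn y)) with hqdef
  have hl0 : 0 < lam x :=
    div_pos (cubeNorm_pos_of_mem_distinctAbs hn hx) (cubeNorm_pos_of_mem_distinctAbs hn hw)
  have hd : HasFDerivAt (frozenFormula hn K θ)
      (lam x • (rotationCLM hn θ).comp (horiz hn) +
        (fderiv ℝ lam x).smulRight (rotationCLM hn θ (horiz hn x)) +
        (EuclideanSpace.proj (𝕜 := ℝ) (idxLast hn) + fderiv ℝ q x).smulRight (axis hn)) x :=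
    (hl.hasFDerivAt.fun_smul ((rotationCLM hn θ).comp (horiz hn)).hasFDerivAt).fun_add
      (((EuclideanSpace.proj (𝕜 := ℝ) (idxLast hn)).hasFDerivAt.fun_add hq.hasFDerivAt).smul_const
        (axis hn))
  refine ⟨hd.differentiableAt, ?_⟩
  -- The ratio is constant along horizontal rays and vertical lines: c = 1 + t and c = 1 below give
  -- the two vanishing derivatives.
  have hlam_congr : ∀ {y : EuclideanSpace ℝ (Fin n)} {c : ℝ}, 0 < c →
      horiz hn y = c • horiz hn x → lam y = lam x := by
    intro y c hc hy
    have h1 : cubeNorm hn y = c * cubeNorm hn x := by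
      rw [← cubeNorm_horiz, hy, cubeNorm_smul, cubeNorm_horiz, abs_of_pos hc]
    have h2 : cubeNorm hn (planeRotation hn θ y) = c * cubeNorm hn (planeRotation hn θ x) := by
      rw [← cubeNorm_horiz, horiz_planeRotation, hy, planeRotation_smul, cubeNorm_smul,
        ← horiz_planeRotation, cubeNorm_horiz, abs_of_pos hc]
    rw [hlam]
    simp only [h1, h2]
    rw [mul_div_mul_left _ _ hc.ne']
  have e1 : fderiv ℝ lam x (horiz hn x) = 0 := by
    refine fderiv_apply_eq_zero_of_eventually_eq hl ?_
    filter_upwards [lt_mem_nhds (show (-1 : ℝ) < 0 by norm_num)] with t ht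
    refine hlam_congr (show 0 < 1 + t by linarith) ?_
    rw [map_add, map_smul, horiz_horiz]; module
  have e2 : fderiv ℝ lam x (axis hn) = 0 := by
    refine fderiv_apply_eq_zero_of_eventually_eq hl (Eventually.of_forall fun t => ?_)
    refine hlam_congr one_pos ?_
    rw [map_add, map_smul, horiz_axis, smul_zero, add_zero, one_smul]
  have e3 : fderiv ℝ q x (axis hn) = 0 := by
    refine fderiv_apply_eq_zero_of_eventually_eq hq (Eventually.of_forall fun t => ?_)
    rw [hqdef]
    simp only [zorichDirection₁_add_axis]
  -- Pulling out the scalar λ also stretches the vertical axis; the term λ⁻¹ - 1 in b undoes this.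
  -- So 1 + b(e) = λ⁻¹ and λⁿ becomes λ^(n-1).
  rw [hd.fderiv, ContinuousLinearMap.det, LinearMap.det_eq_of_forall_apply (ρ := rotationL hn θ)
    (l := lam x) (a := ((lam x)⁻¹ • fderiv ℝ lam x : _ →L[ℝ] ℝ).toLinearMap)
    (b := (((lam x)⁻¹ - 1) • EuclideanSpace.proj (𝕜 := ℝ) (idxLast hn) +
      (lam x)⁻¹ • fderiv ℝ q x : _ →L[ℝ] ℝ).toLinearMap) (p := horiz hn x) (e := axis hn) ?_
    (det_rotationL hn θ) (by simp [e1]) (by simp [e2])]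
  · simp [e3]
    obtain ⟨m, rfl⟩ : ∃ m, n = m + 1 := ⟨n - 1, by omega⟩
    rw [pow_succ, mul_assoc, mul_inv_cancel₀ hl0.ne', mul_one, Nat.add_sub_cancel]
  · intro v
    have hv : rotationL hn θ v =
        rotationL hn θ (horiz hn v) + v (idxLast hn) • axis hn := by
      conv_lhs => rw [eq_horiz_add hn v]
      rw [map_add, map_smul, rotationL_apply hn θ (axis hn), planeRotation_axis]
    rw [map_add, map_add, map_smul, map_smul, rotationL_apply hn θ (axis hn), planeRotation_axis,
      hv]
    simp only [ContinuousLinearMap.coe_coe, add_apply, smul_apply, ContinuousLinearMap.comp_apply,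
      ContinuousLinearMap.smulRight_apply, rotationCLM_apply, rotationL_apply, smul_add, smul_smul,
      smul_eq_mul, PiLp.proj_apply]
    have h1 : lam x * ((lam x)⁻¹ * fderiv ℝ lam x v) = fderiv ℝ lam x v :=
      mul_inv_cancel_left₀ hl0.ne' _
    have h2 : lam x * (((lam x)⁻¹ - 1) * v (idxLast hn) + (lam x)⁻¹ * fderiv ℝ q x v) =
        v (idxLast hn) + fderiv ℝ q x v - lam x * v (idxLast hn) := by
      field_simp; ring
    rw [h1, h2]
    module

/-- The frozen Jacobian is at least 2^(-(n-1)/2), twice the target; the slack equals the target and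
is what the perturbation may consume. -/
lemma two_rpow_le_pow (hn : 3 ≤ n) {t : ℝ} (ht : 1 ≤ √2 * t) :
    2 * (2 : ℝ) ^ (-((n : ℝ) + 1) / 2) ≤ t ^ (n - 1) := by
  have h2 : (0 : ℝ) < √2 := by positivity
  have h : (√2)⁻¹ ≤ t := by rwa [inv_le_iff_one_le_mul₀ h2, mul_comm]
  refine le_trans (le_of_eq ?_) (pow_le_pow_left₀ (by positivity) h (n - 1))
  rw [← Real.rpow_natCast, Real.sqrt_eq_rpow, ← Real.rpow_neg zero_le_two,
    ← Real.rpow_mul zero_le_two]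
  nth_rewrite 1 [← Real.rpow_one 2]
  rw [← Real.rpow_add two_pos, Nat.cast_sub (by omega)]
  congr 1
  push_cast
  ring

/-- Same freezing argument as for R_s, now with the angle αxₙ. Points of the cell have bounded
horizontal part, so the derivative changes by at most 8n(n+1)|α|, uniformly in x. -/
lemma exists_det_spiralFormula (hn : 3 ≤ n) {K : ℝ} (hK : 1 ≤ K) :
    ∃ α₀ > 0, ∀ α : ℝ, |α| < α₀ → ∀ x ∈ openCell hn, x ∈ distinctAbs hn →
      planeRotation hn (α * x (idxLast hn)) x ∈ distinctAbs hn →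
      DifferentiableAt ℝ (spiralFormula hn K α) x ∧
      ‖fderiv ℝ (spiralFormula hn K α) x‖ ≤ formulaLip n K ∧
      (2 : ℝ) ^ (-((n : ℝ) + 1) / 2) < (fderiv ℝ (spiralFormula hn K α) x).det := by
  set L := formulaLip n K with hL
  have hLpos : 0 < L := formulaLip_pos n hK
  have hn0 : (0 : ℝ) < n := by exact_mod_cast (by omega : 0 < n)
  obtain ⟨δ, hδ, h⟩ := ContinuousLinearMap.exists_forall_det_sub_lt
    (V := EuclideanSpace ℝ (Fin n)) (L + 8 * n * (n + 1))
    (show (0 : ℝ) < (2 : ℝ) ^ (-((n : ℝ) + 1) / 2) by positivity)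
  refine ⟨min 1 (δ / (8 * n * (n + 1))), by positivity, fun α hα x hxo hx hw => ?_⟩
  have hα1 : |α| < 1 := hα.trans_le (min_le_left _ _)
  have hα2 : 8 * n * (n + 1) * |α| < δ := by
    have := hα.trans_le (min_le_right _ _)
    rwa [lt_div_iff₀ (by positivity), mul_comm] at this
  have hF := differentiableAt_spiralFormula hn hK α hx hw
  have hnhds : openCell hn ∈ 𝓝 x := by
    have hcont : Continuous (cubeNorm hn) := by
      refine (LipschitzWith.mk_one fun x y => ?_).continuous
      rw [Real.dist_eq, dist_eq_norm]
      refine (abs_cubeNorm_sub_le hn x y).trans ?_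
      rw [← map_sub]
      exact norm_horiz_le hn _
    filter_upwards [hcont.tendsto x |>.eventually (gt_mem_nhds ((mem_openCell_iff hn).1 hxo))]
      with y hy
    exact (mem_openCell_iff hn).2 hy
  have hFn : ‖fderiv ℝ (spiralFormula hn K α) x‖ ≤ L := by
    have := norm_fderiv_le_of_lipschitzOn ℝ
      (Filter.mem_of_superset hnhds (openCell_subset_closedCell hn))
      (lipschitzOnWith_spiralFormula hn hK hα1.le)
    rwa [Real.coe_toNNReal _ hLpos.le] at this
  refine ⟨hF, hFn, ?_⟩
  obtain ⟨hG, hGdet⟩ := det_fderiv_frozenFormula hn hK (α * x (idxLast hn)) hx hw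
  set G := frozenFormula hn K (α * x (idxLast hn)) with hGdef
  have hFG : ‖fderiv ℝ (spiralFormula hn K α) x - fderiv ℝ G x‖ ≤ 8 * n * (n + 1) * |α| := by
    refine (hF.hasFDerivAt.sub hG.hasFDerivAt).le_of_lip' (by positivity) ?_
    filter_upwards [hnhds] with y hy
    have e0 : spiralFormula hn K α x - G x = 0 := by
      rw [spiralFormula_eq hn hK, hGdef, frozenFormula, sub_self]
    have e1 : spiralFormula hn K α y - G y =
        spiralHoriz hn (α * y (idxLast hn)) y - spiralHoriz hn (α * x (idxLast hn)) y := by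
      rw [spiralFormula_eq hn hK, hGdef, frozenFormula, add_sub_add_right_eq_sub]
    simp only [Pi.sub_apply, e0, sub_zero]
    rw [e1]
    -- The vertical parts cancel and the point is the same in both slots, so only the change of
    -- angle contributes.
    refine (norm_spiralHoriz_sub_le hn _ _ y y).trans ?_
    rw [sub_self, norm_zero, mul_zero, zero_add, ← mul_sub, abs_mul]
    have hlast : |y (idxLast hn) - x (idxLast hn)| ≤ ‖y - x‖ := abs_apply_le_norm (y - x) _
    calc 4 * (n + 1) * (|α| * |y (idxLast hn) - x (idxLast hn)|) * ‖horiz hn y‖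
        ≤ 4 * (n + 1) * (|α| * ‖y - x‖) * (2 * n) := by
          gcongr
          exact norm_horiz_le_of_mem_closedCell hn (openCell_subset_closedCell hn hy)
      _ = _ := by ring
  have hGn : ‖fderiv ℝ G x‖ ≤ L + 8 * n * (n + 1) := by
    have h1 := norm_sub_le (fderiv ℝ (spiralFormula hn K α) x)
      (fderiv ℝ (spiralFormula hn K α) x - fderiv ℝ G x)
    rw [sub_sub_cancel] at h1
    have : 8 * n * (n + 1) * |α| ≤ 8 * n * (n + 1) * 1 := by gcongr
    linarith
  have hdet := h _ _ (hFn.trans (le_add_of_nonneg_right (by positivity))) hGn (hFG.trans_lt hα2)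
  have hratio : 1 ≤ √2 *
      (cubeNorm hn x / cubeNorm hn (planeRotation hn (α * x (idxLast hn)) x)) := by
    rw [← mul_div_assoc, one_le_div (cubeNorm_pos_of_mem_distinctAbs hn hw)]
    exact cubeNorm_planeRotation_le hn _ x
  have := two_rpow_le_pow hn hratio
  rw [← hGdet] at this
  linarith

end Zorich

/-! ### Sets of σ-finite Hausdorff measure -/

/-- `S` is covered by countably many sets of finite `d`-dimensional Hausdorff measure. -/
def IsHausdorffSigmaFinite {X : Type*} [EMetricSpace X] [MeasurableSpace X] [BorelSpace X]
    (d : ℝ) (S : Set X) : Prop :=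
  ∃ T : Set (Set X), T.Countable ∧ (∀ t ∈ T, Measure.hausdorffMeasure d t < ⊤) ∧ S ⊆ ⋃₀ T

namespace IsHausdorffSigmaFinite

lemma mono {X : Type*} [EMetricSpace X] [MeasurableSpace X] [BorelSpace X] {d : ℝ} {S S' : Set X}
    (h : IsHausdorffSigmaFinite d S) (hS : S' ⊆ S) : IsHausdorffSigmaFinite d S' := by
  obtain ⟨T, hT, hfin, hcov⟩ := h
  exact ⟨T, hT, hfin, hS.trans hcov⟩

lemma iUnion {X ι : Type*} [EMetricSpace X] [MeasurableSpace X] [BorelSpace X] [Countable ι]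
    {d : ℝ} {S : ι → Set X} (h : ∀ i, IsHausdorffSigmaFinite d (S i)) :
    IsHausdorffSigmaFinite d (⋃ i, S i) := by
  choose T hT hfin hcov using h
  refine ⟨⋃ i, T i, Set.countable_iUnion hT, fun t ht => ?_, Set.iUnion_subset fun i => ?_⟩
  · obtain ⟨i, hi⟩ := Set.mem_iUnion.1 ht
    exact hfin i t hi
  · exact (hcov i).trans (Set.sUnion_subset_sUnion (Set.subset_iUnion T i))

lemma union {X : Type*} [EMetricSpace X] [MeasurableSpace X] [BorelSpace X] {d : ℝ} {S S' : Set X}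
    (h : IsHausdorffSigmaFinite d S) (h' : IsHausdorffSigmaFinite d S') :
    IsHausdorffSigmaFinite d (S ∪ S') := by
  rw [Set.union_eq_iUnion]
  exact iUnion fun b => by cases b <;> assumption

/-- A C¹ map is Lipschitz only on bounded convex sets, so each covering piece is first cut by the
balls of integer radius. -/
lemma image {V W : Type*} [NormedAddCommGroup V] [NormedSpace ℝ V] [FiniteDimensional ℝ V]
    [MeasurableSpace V] [BorelSpace V] [NormedAddCommGroup W] [NormedSpace ℝ W]
    [MeasurableSpace W] [BorelSpace W] {d : ℝ} (hd : 0 ≤ d) {S : Set V}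
    (h : IsHausdorffSigmaFinite d S) {f : V → W} (hf : ContDiff ℝ 1 f) :
    IsHausdorffSigmaFinite d (f '' S) := by
  obtain ⟨T, hT, hfin, hcov⟩ := h
  refine ⟨Set.image2 (fun t (k : ℕ) => f '' (t ∩ Metric.closedBall 0 k)) T Set.univ,
    hT.image2 Set.countable_univ _, ?_, ?_⟩
  · rintro _ ⟨t, ht, k, -, rfl⟩
    have : ProperSpace V := FiniteDimensional.proper ℝ V
    obtain ⟨C, hC⟩ := hf.contDiffOn.exists_lipschitzOnWith one_ne_zero
      (convex_closedBall (0 : V) k) (isCompact_closedBall 0 k)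
    refine ((hC.mono Set.inter_subset_right).hausdorffMeasure_image_le hd).trans_lt ?_
    exact ENNReal.mul_lt_top (ENNReal.rpow_lt_top_of_nonneg hd ENNReal.coe_ne_top)
      ((measure_mono Set.inter_subset_left).trans_lt (hfin t ht))
  · rintro _ ⟨x, hx, rfl⟩
    obtain ⟨t, ht, hxt⟩ := hcov hx
    obtain ⟨k, hk⟩ := exists_nat_ge ‖x‖
    exact ⟨_, ⟨t, ht, k, Set.mem_univ _, rfl⟩, x, ⟨hxt, by simpa using hk⟩, rfl⟩

lemma sigmaFinite_restrict {X : Type*} [EMetricSpace X] [MeasurableSpace X] [BorelSpace X] {d : ℝ}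
    {S : Set X} (h : IsHausdorffSigmaFinite d S) (hS : MeasurableSet S) :
    SigmaFinite ((Measure.hausdorffMeasure d).restrict S) := by
  obtain ⟨T, hT, hfin, hcov⟩ := h
  -- The complement of S is null for the restricted measure, so adding it completes the cover of the
  -- space.
  refine Measure.sigmaFinite_of_countable (hT.insert Sᶜ) ?_ ?_
  · rintro t (rfl | ht)
    · rw [Measure.restrict_apply hS.compl, Set.compl_inter_self, measure_empty]
      exact ENNReal.zero_lt_top
    · exact (Measure.restrict_apply_le S t).trans_lt (hfin t ht)
  · rw [Set.sUnion_insert, Set.eq_univ_iff_forall]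
    intro x
    by_cases hx : x ∈ S
    · exact Or.inr (hcov hx)
    · exact Or.inl hx

/-- Finite measure in dimension n - 1 forces measure zero in dimension n, where Hausdorff measure is
a Haar measure and hence has the Lebesgue null sets. -/
lemma volume_eq_zero {n : ℕ} {S : Set (EuclideanSpace ℝ (Fin n))}
    (h : IsHausdorffSigmaFinite ((n : ℝ) - 1) S) : volume S = 0 := by
  obtain ⟨T, hT, hfin, hcov⟩ := h
  refine measure_mono_null hcov ((measure_sUnion_null_iff hT).2 fun t ht => ?_)
  have h0 : Measure.hausdorffMeasure (n : ℝ) t = 0 :=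
    (Measure.hausdorffMeasure_zero_or_top (sub_one_lt (n : ℝ)) t).resolve_right (hfin t ht).ne
  have hH : Measure.IsAddHaarMeasure
      (Measure.hausdorffMeasure (n : ℝ) : Measure (EuclideanSpace ℝ (Fin n))) := by
    simpa using MeasureTheory.isAddHaarMeasure_hausdorffMeasure (E := EuclideanSpace ℝ (Fin n))
  exact Measure.absolutelyContinuous_isAddHaarMeasure volume
    (Measure.hausdorffMeasure (n : ℝ) : Measure (EuclideanSpace ℝ (Fin n))) h0

/-- A hypersurface which is the graph of a `C¹` function over a coordinate hyperplane. -/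
lemma graph {n : ℕ} (i : Fin n) {g : ({k : Fin n // k ≠ i} → ℝ) → ℝ} (hg : ContDiff ℝ 1 g) :
    IsHausdorffSigmaFinite ((n : ℝ) - 1)
      {x : EuclideanSpace ℝ (Fin n) | x i = g fun k => x k} := by
  have hpos : 0 < n := i.pos
  have hcard : ((Fintype.card {k : Fin n // k ≠ i} : ℕ) : ℝ) = (n : ℝ) - 1 := by
    rw [Fintype.card_subtype_compl, Fintype.card_fin, Fintype.card_subtype_eq,
      Nat.cast_sub hpos, Nat.cast_one]
  have huniv : IsHausdorffSigmaFinite ((n : ℝ) - 1)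
      (Set.univ : Set ({k : Fin n // k ≠ i} → ℝ)) := by
    refine ⟨Set.range fun m : ℕ => Metric.closedBall 0 m, Set.countable_range _, ?_, ?_⟩
    · rintro _ ⟨m, rfl⟩
      -- On a product of n - 1 lines with the sup metric this Hausdorff measure is Lebesgue measure,
      -- which is finite on balls.
      rw [← hcard, hausdorffMeasure_pi_real]
      exact (isCompact_closedBall _ _).measure_lt_top
    · intro x _
      obtain ⟨m, hm⟩ := exists_nat_ge ‖x‖
      exact ⟨_, ⟨m, rfl⟩, by simpa using hm⟩
  let f : ({k : Fin n // k ≠ i} → ℝ) → EuclideanSpace ℝ (Fin n) := fun y =>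
    WithLp.toLp 2 fun k => if h : k ≠ i then y ⟨k, h⟩ else g y
  have hf : ContDiff ℝ 1 f := by
    rw [contDiff_euclidean]
    intro k
    by_cases h : k ≠ i
    · simp only [f, h, dite_true, not_false_eq_true, ne_eq]
      exact contDiff_apply ℝ ℝ _
    · simp only [f, h, dite_false]
      exact hg
  refine (huniv.image (by rw [← hcard]; positivity) hf).mono fun x hx => ⟨fun k => x k, trivial, ?_⟩
  ext k
  by_cases h : k ≠ i
  · simp [f, h]
  · rw [not_not] at h
    subst h
    simpa [f] using (Set.mem_ofPred_eq ▸ hx).symm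

end IsHausdorffSigmaFinite

/-! ### The exceptional set. -/

namespace Zorich
variable {n : ℕ}

lemma isOpen_distinctAbs (hn : 3 ≤ n) : IsOpen (distinctAbs hn) := by
  simp only [distinctAbs, Set.ofPred_forall]
  refine isOpen_iInter_of_finite fun i => isOpen_iInter_of_finite fun j =>
    isOpen_iInter_of_finite fun _ => isOpen_iInter_of_finite fun _ =>
    isOpen_iInter_of_finite fun _ => ?_
  exact isOpen_ne_fun (by fun_prop) (by fun_prop)

/-- Ties lie in the finitely many hyperplanes xᵢ = ±xⱼ. -/
lemma isHausdorffSigmaFinite_distinctAbs_compl (hn : 3 ≤ n) :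
    IsHausdorffSigmaFinite ((n : ℝ) - 1) (distinctAbs hn)ᶜ := by
  have h : ∀ (p : {p : Fin n × Fin n // p.2 ≠ p.1}), IsHausdorffSigmaFinite ((n : ℝ) - 1)
      {x : EuclideanSpace ℝ (Fin n) | |x p.1.1| = |x p.1.2|} := fun p => by
    have h1 := IsHausdorffSigmaFinite.graph p.1.1 (g := fun y => y ⟨p.1.2, p.2⟩)
      (contDiff_apply ℝ ℝ _)
    have h2 := IsHausdorffSigmaFinite.graph p.1.1 (g := fun y => - y ⟨p.1.2, p.2⟩)
      (contDiff_apply ℝ ℝ _).neg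
    exact (h1.union h2).mono fun x hx => abs_eq_abs.1 hx
  refine (IsHausdorffSigmaFinite.iUnion h).mono fun x hx => ?_
  simp only [distinctAbs, Set.mem_compl_iff, Set.mem_ofPred_eq, not_forall, not_not] at hx
  obtain ⟨i, j, -, -, hij, hx⟩ := hx
  exact Set.mem_iUnion.2 ⟨⟨(i, j), Ne.symm hij⟩, hx⟩

lemma contDiff_twist (hn : 3 ≤ n) (α : ℝ) :
    ContDiff ℝ 1 fun x : EuclideanSpace ℝ (Fin n) => planeRotation hn (α * x (idxLast hn)) x := by
  have h : ContDiff ℝ 1 fun x : EuclideanSpace ℝ (Fin n) => x (idxLast hn) :=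
    (EuclideanSpace.proj (𝕜 := ℝ) (idxLast hn)).contDiff
  exact (contDiff_planeRotation hn).comp ((contDiff_const.mul h).prodMk contDiff_id)

/-- The set where the explicit formula may fail to be differentiable. -/
def creaseSet (hn : 3 ≤ n) (α : ℝ) : Set (EuclideanSpace ℝ (Fin n)) :=
  (distinctAbs hn)ᶜ ∪ {x | planeRotation hn (α * x (idxLast hn)) x ∈ (distinctAbs hn)ᶜ}

lemma isClosed_creaseSet (hn : 3 ≤ n) (α : ℝ) : IsClosed (creaseSet hn α) :=
  (isOpen_distinctAbs hn).isClosed_compl.union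
    ((isOpen_distinctAbs hn).isClosed_compl.preimage (contDiff_twist hn α).continuous)

lemma sub_one_nonneg_of_three_le (hn : 3 ≤ n) : (0 : ℝ) ≤ (n : ℝ) - 1 := by
  have : (3 : ℝ) ≤ n := by exact_mod_cast hn
  linarith

/-- The twist by αxₙ keeps xₙ, so the twist by -αxₙ inverts it. The ties of w are therefore a smooth
image of the ties of x. -/
lemma isHausdorffSigmaFinite_creaseSet (hn : 3 ≤ n) (α : ℝ) :
    IsHausdorffSigmaFinite ((n : ℝ) - 1) (creaseSet hn α) := by
  have h := isHausdorffSigmaFinite_distinctAbs_compl hn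
  refine h.union ((h.image (sub_one_nonneg_of_three_le hn) (contDiff_twist hn (-α))).mono
    fun x hx => ⟨_, hx, ?_⟩)
  simp only [planeRotation_last, planeRotation_planeRotation]
  rw [neg_mul, neg_add_cancel, planeRotation_zero]

/-- The linear part of `reflectFace`. -/
def reflectLinear (hn : 3 ≤ n) : EuclideanSpace ℝ (Fin n) →L[ℝ] EuclideanSpace ℝ (Fin n) :=
  ContinuousLinearMap.id ℝ _ - (2 : ℝ) •
    (EuclideanSpace.proj (𝕜 := ℝ) (idx₁ hn)).smulRight (EuclideanSpace.single (idx₁ hn) 1)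

lemma reflectFace_eq (hn : 3 ≤ n) (x : EuclideanSpace ℝ (Fin n)) :
    reflectFace hn x =
      reflectLinear hn x + Real.pi • EuclideanSpace.single (idx₁ hn) (1 : ℝ) := by
  ext i
  by_cases hi : i = idx₁ hn
  · subst hi
    simp [reflectFace, reflectLinear]; ring
  · simp [reflectFace, reflectLinear, hi]

lemma hasFDerivAt_reflectFace (hn : 3 ≤ n) (x : EuclideanSpace ℝ (Fin n)) :
    HasFDerivAt (reflectFace hn) (reflectLinear hn) x :=
  ((reflectLinear hn).hasFDerivAt.add_const _).congr_of_eventuallyEq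
    (Filter.Eventually.of_forall (reflectFace_eq hn))

lemma contDiff_reflectFace (hn : 3 ≤ n) : ContDiff ℝ 1 (reflectFace hn) := by
  rw [funext (reflectFace_eq hn)]
  exact (reflectLinear hn).contDiff.add contDiff_const

lemma norm_reflectLinear (hn : 3 ≤ n) (x : EuclideanSpace ℝ (Fin n)) :
    ‖reflectLinear hn x‖ = ‖x‖ := by
  rw [EuclideanSpace.norm_eq, EuclideanSpace.norm_eq]
  congr 1
  refine Finset.sum_congr rfl fun i _ => ?_
  by_cases hi : i = idx₁ hn
  · subst hi
    have : reflectLinear hn x (idx₁ hn) = - x (idx₁ hn) := by simp [reflectLinear]; ring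
    rw [this, norm_neg]
  · simp [reflectLinear, hi]

/-- The affine reflection is an involution at x and at 0; subtracting shows that its linear part is
one too. The sign is not needed, since the reflection acts on both sides of the formula. -/
lemma det_reflectLinear_mul_self (hn : 3 ≤ n) :
    (reflectLinear hn).det * (reflectLinear hn).det = 1 := by
  rw [ContinuousLinearMap.det, ← LinearMap.det_comp,
    ← LinearMap.det_id (A := ℝ) (M := EuclideanSpace ℝ (Fin n))]
  congr 1
  refine LinearMap.ext fun x => ?_
  have h0 := reflectFace_reflectFace hn (0 : EuclideanSpace ℝ (Fin n))
  have hx := reflectFace_reflectFace hn x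
  rw [reflectFace_eq, reflectFace_eq, map_add] at h0 hx
  rw [map_zero, map_zero, zero_add] at h0
  rw [add_assoc, h0, add_zero] at hx
  exact hx

lemma dist_reflectFace (hn : 3 ≤ n) (x y : EuclideanSpace ℝ (Fin n)) :
    dist (reflectFace hn x) (reflectFace hn y) = dist x y := by
  rw [dist_eq_norm, dist_eq_norm, reflectFace_eq, reflectFace_eq, add_sub_add_right_eq_sub,
    ← map_sub, norm_reflectLinear]

/-- The union of the faces `|xᵢ| = π/2`. -/
def faceSet (hn : 3 ≤ n) : Set (EuclideanSpace ℝ (Fin n)) :=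
  {x | ∃ i, i ≠ idxLast hn ∧ |x i| = Real.pi / 2}

lemma isClosed_faceSet (hn : 3 ≤ n) : IsClosed (faceSet hn) := by
  simp only [faceSet, Set.ofPred_exists]
  refine isClosed_iUnion_of_finite fun i => ?_
  by_cases hi : i = idxLast hn
  · simp [hi]
  · simp only [hi, ne_eq, not_false_eq_true, true_and]
    exact isClosed_eq (by fun_prop) (by fun_prop)

lemma isHausdorffSigmaFinite_faceSet (hn : 3 ≤ n) :
    IsHausdorffSigmaFinite ((n : ℝ) - 1) (faceSet hn) := by
  have h : ∀ i : Fin n, IsHausdorffSigmaFinite ((n : ℝ) - 1)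
      {x : EuclideanSpace ℝ (Fin n) | |x i| = Real.pi / 2} := fun i => by
    have h1 := IsHausdorffSigmaFinite.graph i (g := fun _ => Real.pi / 2) contDiff_const
    have h2 := IsHausdorffSigmaFinite.graph i (g := fun _ => -(Real.pi / 2)) contDiff_const
    exact (h1.union h2).mono fun x hx => (abs_eq (by positivity)).1 hx
  refine (IsHausdorffSigmaFinite.iUnion h).mono ?_
  rintro x ⟨i, -, hi⟩
  exact Set.mem_iUnion.2 ⟨i, hi⟩

/-- The exceptional set of the Zorich transform of `R_s`. -/
def exceptionalSet (hn : 3 ≤ n) (α : ℝ) : Set (EuclideanSpace ℝ (Fin n)) :=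
  creaseSet hn α ∪ reflectFace hn ⁻¹' creaseSet hn α ∪ faceSet hn

lemma isClosed_exceptionalSet (hn : 3 ≤ n) (α : ℝ) : IsClosed (exceptionalSet hn α) :=
  ((isClosed_creaseSet hn α).union ((isClosed_creaseSet hn α).preimage
    (contDiff_reflectFace hn).continuous)).union (isClosed_faceSet hn)

lemma isHausdorffSigmaFinite_exceptionalSet (hn : 3 ≤ n) (α : ℝ) :
    IsHausdorffSigmaFinite ((n : ℝ) - 1) (exceptionalSet hn α) := by
  have h := isHausdorffSigmaFinite_creaseSet hn α
  exact (h.union ((h.image (sub_one_nonneg_of_three_le hn) (contDiff_reflectFace hn)).mono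
    fun x hx => ⟨reflectFace hn x, hx, reflectFace_reflectFace hn x⟩)).union (isHausdorffSigmaFinite_faceSet hn)

/-! ### The cells and the main theorem -/

lemma isOpen_openCell (hn : 3 ≤ n) : IsOpen (openCell hn) := by
  simp only [openCell, Set.ofPred_forall]
  exact isOpen_iInter_of_finite fun i => isOpen_iInter_of_finite fun _ =>
    isOpen_lt (by fun_prop) (by fun_prop)

lemma isConnected_openCell (hn : 3 ≤ n) : IsConnected (openCell hn) := by
  refine ⟨⟨0, fun i _ => by simp [Real.pi_pos]⟩, Convex.isPreconnected ?_⟩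
  intro x hx y hy a b ha hb hab
  rw [mem_openCell_iff] at hx hy ⊢
  obtain ⟨i, hi, h⟩ := exists_abs_eq_cubeNorm hn (a • x + b • y)
  rw [← h]
  have h1 := abs_add_le (a * x i) (b * y i)
  rw [abs_mul, abs_mul, abs_of_nonneg ha, abs_of_nonneg hb] at h1
  have h2 := (abs_le_cubeNorm hn x hi).trans_lt hx
  have h3 := (abs_le_cubeNorm hn y hi).trans_lt hy
  have h4 : a * |x i| + b * |y i| < Real.pi / 2 := by
    rcases ha.eq_or_lt with rfl | ha
    · obtain rfl : b = 1 := by linarith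
      linarith
    · have hb' : b = 1 - a := by linarith
      subst hb'
      nlinarith
  simpa using h1.trans_lt h4

lemma openCell'_eq_preimage (hn : 3 ≤ n) : openCell' hn = reflectFace hn ⁻¹' openCell hn :=
  Set.ext fun _ => (reflectFace_mem_openCell_iff hn).symm

lemma openCell'_eq_image (hn : 3 ≤ n) : openCell' hn = reflectFace hn '' openCell hn := by
  ext x
  refine ⟨fun h => ⟨_, (reflectFace_mem_openCell_iff hn).2 h, reflectFace_reflectFace hn x⟩, ?_⟩
  rintro ⟨y, hy, rfl⟩
  exact (reflectFace_mem_openCell'_iff hn).2 hy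

lemma isOpen_openCell' (hn : 3 ≤ n) : IsOpen (openCell' hn) := by
  rw [openCell'_eq_preimage]
  exact (isOpen_openCell hn).preimage (contDiff_reflectFace hn).continuous

lemma isConnected_openCell' (hn : 3 ≤ n) : IsConnected (openCell' hn) := by
  rw [openCell'_eq_image]
  exact (isConnected_openCell hn).image _ (contDiff_reflectFace hn).continuous.continuousOn

lemma lipschitzOnWith_zorichTransform_openCell (hn : 3 ≤ n) {K α : ℝ} (hK : 1 ≤ K)
    (hα : |α| ≤ 1) : LipschitzOnWith (formulaLip n K).toNNReal
      (zorichTransform hn (spiralStretch hn K α)) (openCell hn) := by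
  intro x hx y hy
  have hx := openCell_subset_closedCell hn hx
  have hy := openCell_subset_closedCell hn hy
  rw [zorichTransform_spiralStretch hn hK α hx, zorichTransform_spiralStretch hn hK α hy]
  exact lipschitzOnWith_spiralFormula hn hK hα hx hy

lemma lipschitzOnWith_zorichTransform_openCell' (hn : 3 ≤ n) {K α : ℝ} (hK : 1 ≤ K)
    (hα : |α| ≤ 1) : LipschitzOnWith (formulaLip n K).toNNReal
      (zorichTransform hn (spiralStretch hn K α)) (openCell' hn) := by
  refine LipschitzOnWith.of_dist_le_mul fun x hx y hy => ?_
  rw [zorichTransform_spiralStretch_of_mem_openCell' hn hK α hx,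
    zorichTransform_spiralStretch_of_mem_openCell' hn hK α hy, dist_reflectFace]
  have hmem : ∀ {z}, z ∈ openCell' hn → reflectFace hn z ∈ closedCell hn := fun hz =>
    openCell_subset_closedCell hn ((reflectFace_mem_openCell_iff hn).2 hz)
  have := (lipschitzOnWith_spiralFormula hn hK hα).dist_le_mul _ (hmem hx) _ (hmem hy)
  rwa [dist_reflectFace] at this

-- Off the faces a point of B is interior to one of the two cells, so a formula holds in a
-- neighbourhood. On the second cell it is conjugated by an isometric reflection, which preserves
-- the norm bound and the determinant.
open Filter Topology in
lemma exists_det_zorichTransform (hn : 3 ≤ n) {K : ℝ} (hK : 1 ≤ K) :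
    ∃ α₀ > 0, ∀ α : ℝ, |α| < α₀ → ∀ x ∈ fundamentalSet hn \ exceptionalSet hn α,
      DifferentiableAt ℝ (zorichTransform hn (spiralStretch hn K α)) x ∧
      ‖fderiv ℝ (zorichTransform hn (spiralStretch hn K α)) x‖ ≤ formulaLip n K ∧
      (2 : ℝ) ^ (-((n : ℝ) + 1) / 2) <
        (fderiv ℝ (zorichTransform hn (spiralStretch hn K α)) x).det := by
  obtain ⟨α₀, hα₀, h⟩ := exists_det_spiralFormula hn hK
  refine ⟨α₀, hα₀, fun α hα x hx => ?_⟩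
  obtain ⟨hxB, hxE⟩ := hx
  simp only [exceptionalSet, Set.mem_union, not_or, creaseSet, Set.mem_preimage,
    Set.mem_ofPred_eq, Set.mem_compl_iff, not_not] at hxE
  obtain ⟨⟨⟨h1, h2⟩, h3, h4⟩, h5⟩ := hxE
  rcases hxB with hxc | hxo
  · have hxo : x ∈ openCell hn := fun i hi =>
      lt_of_le_of_ne (hxc i hi) fun h' => h5 ⟨i, hi, h'⟩
    have hev : zorichTransform hn (spiralStretch hn K α) =ᶠ[𝓝 x] spiralFormula hn K α :=
      Filter.eventuallyEq_of_mem ((isOpen_openCell hn).mem_nhds hxo) fun y hy =>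
        zorichTransform_spiralStretch hn hK α (openCell_subset_closedCell hn hy)
    rw [hev.differentiableAt_iff, hev.fderiv_eq]
    exact h α hα x hxo h1 h2
  · obtain ⟨hd, hnorm, hdet⟩ :=
      h α hα _ ((reflectFace_mem_openCell_iff hn).2 hxo) h3 h4
    have hev : zorichTransform hn (spiralStretch hn K α) =ᶠ[𝓝 x]
        fun y => reflectFace hn (spiralFormula hn K α (reflectFace hn y)) :=
      Filter.eventuallyEq_of_mem ((isOpen_openCell' hn).mem_nhds hxo) fun y hy =>
        zorichTransform_spiralStretch_of_mem_openCell' hn hK α hy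
    have hD := ((hasFDerivAt_reflectFace hn _).comp x
      (hd.hasFDerivAt.comp x (hasFDerivAt_reflectFace hn x))).congr_of_eventuallyEq hev
    set D := fderiv ℝ (spiralFormula hn K α) (reflectFace hn x)
    refine ⟨hD.differentiableAt, ?_, ?_⟩
    · rw [hD.fderiv]
      refine (ContinuousLinearMap.opNorm_le_bound _ (norm_nonneg D) fun v => ?_).trans hnorm
      rw [ContinuousLinearMap.comp_apply, ContinuousLinearMap.comp_apply, norm_reflectLinear]
      refine (D.le_opNorm _).trans ?_
      rw [norm_reflectLinear]
    · have e : ((reflectLinear hn).comp (D.comp (reflectLinear hn))).det = D.det := by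
        have h0 := det_reflectLinear_mul_self hn
        simp only [ContinuousLinearMap.det, ContinuousLinearMap.toLinearMap_comp,
          LinearMap.det_comp] at h0 ⊢
        linear_combination
          (LinearMap.det (D : EuclideanSpace ℝ (Fin n) →ₗ[ℝ] EuclideanSpace ℝ (Fin n))) * h0
      rw [hD.fderiv, e]
      exact hdet

end Zorich

end

theorem mainTheorem6 (n : ℕ) (hn : 3 ≤ n) (K : ℝ) (hK : 1 ≤ K) :
    ∃ α₀ : ℝ, 0 < α₀ ∧ ∃ C : ℝ, ∀ α : ℝ, |α| < α₀ →
      -- the map `R_s` is a quasiconformal homeomorphism of `ℝⁿ`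
      IsHomeomorph (Zorich.spiralStretch hn K α) ∧
      IsQuasiconformalOn (Zorich.spiralStretch hn K α) Set.univ ∧
      -- its Zorich transform is a bijection of `B`, semiconjugate to `R_s`, given by the formula
      Set.BijOn (Zorich.zorichTransform hn (Zorich.spiralStretch hn K α))
        (Zorich.fundamentalSet hn) (Zorich.fundamentalSet hn) ∧
      (∀ x ∈ Zorich.fundamentalSet hn,
        Zorich.zorichMap hn (Zorich.zorichTransform hn (Zorich.spiralStretch hn K α) x) =
          Zorich.spiralStretch hn K α (Zorich.zorichMap hn x)) ∧
      (∀ x ∈ Zorich.closedCell hn,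
        Zorich.zorichTransform hn (Zorich.spiralStretch hn K α) x =
          Zorich.spiralFormula hn K α x) ∧
      -- it is quasiconformal on the two open cells of `B`
      IsQuasiconformalOn (Zorich.zorichTransform hn (Zorich.spiralStretch hn K α))
        (Zorich.openCell hn) ∧
      IsQuasiconformalOn (Zorich.zorichTransform hn (Zorich.spiralStretch hn K α))
        (Zorich.openCell' hn) ∧
      -- bounded derivative and Jacobian bounded below off a closed set of σ-finite `H^{n-1}`
      ∃ E : Set (EuclideanSpace ℝ (Fin n)), IsClosed E ∧
        SigmaFinite ((Measure.hausdorffMeasure ((n : ℝ) - 1)).restrict E) ∧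
        ∀ x ∈ Zorich.fundamentalSet hn \ E,
          DifferentiableAt ℝ (Zorich.zorichTransform hn (Zorich.spiralStretch hn K α)) x ∧
          ‖fderiv ℝ (Zorich.zorichTransform hn (Zorich.spiralStretch hn K α)) x‖ ≤ C ∧
          (2 : ℝ) ^ (-((n : ℝ) + 1) / 2) <
            (fderiv ℝ (Zorich.zorichTransform hn (Zorich.spiralStretch hn K α)) x).det := by
  obtain ⟨α₁, hα₁, h₁⟩ := Zorich.exists_isQuasiconformalOn_spiralStretch hn hK
  obtain ⟨α₂, hα₂, h₂⟩ := Zorich.exists_det_zorichTransform hn hK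
  -- The bound |α| ≤ 1 keeps the Lipschitz constant of the formula independent of α; that constant
  -- serves as C.
  refine ⟨min 1 (min α₁ α₂), by positivity, Zorich.formulaLip n K, fun α hα => ?_⟩
  have hα1 : |α| ≤ 1 := (hα.trans_le (min_le_left _ _)).le
  obtain ⟨hhom, hqc⟩ := h₁ α (hα.trans_le ((min_le_right _ _).trans (min_le_left _ _)))
  have hdet := h₂ α (hα.trans_le ((min_le_right _ _).trans (min_le_right _ _)))
  have hE := Zorich.isHausdorffSigmaFinite_exceptionalSet hn α
  have hEc := Zorich.isClosed_exceptionalSet hn α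
  have hbij := Zorich.zorichTransform_bijOn hn hhom.bijective (Zorich.spiralStretch_zero hn K α)
  -- The exceptional set is Lebesgue null, so the pointwise Jacobian bound gives the a.e. hypothesis
  -- of the quasiregularity criterion on each cell.
  have hae : ∀ {U : Set (EuclideanSpace ℝ (Fin n))}, MeasurableSet U →
      U ⊆ Zorich.fundamentalSet hn → ∀ᵐ x ∂(volume.restrict U),
        (2 : ℝ) ^ (-((n : ℝ) + 1) / 2) ≤
          (fderiv ℝ (Zorich.zorichTransform hn (Zorich.spiralStretch hn K α)) x).det := by
    intro U hU hUB
    have h0 : ∀ᵐ x : EuclideanSpace ℝ (Fin n), x ∉ Zorich.exceptionalSet hn α :=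
      measure_eq_zero_iff_ae_notMem.1 hE.volume_eq_zero
    filter_upwards [ae_restrict_of_ae h0, ae_restrict_mem hU] with x hx hxU
    exact (hdet x ⟨hUB hxU, hx⟩).2.2.le
  have hsub : Zorich.openCell hn ⊆ Zorich.fundamentalSet hn := fun x hx =>
    Or.inl (Zorich.openCell_subset_closedCell hn hx)
  have hsub' : Zorich.openCell' hn ⊆ Zorich.fundamentalSet hn := fun x hx => Or.inr hx
  refine ⟨hhom, hqc, hbij,
    fun x hx => Zorich.zorichMap_zorichTransform hn hhom.injective
      (Zorich.spiralStretch_zero hn K α) hx,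
    fun x hx => Zorich.zorichTransform_spiralStretch hn hK α hx, ⟨?_, hbij.injOn.mono hsub⟩,
    ⟨?_, hbij.injOn.mono hsub'⟩, Zorich.exceptionalSet hn α, hEc,
    hE.sigmaFinite_restrict hEc.measurableSet, hdet⟩
  · exact isQuasiregularOn_of_lipschitzOnWith (Zorich.isOpen_openCell hn)
      (Zorich.isConnected_openCell hn)
      (Zorich.lipschitzOnWith_zorichTransform_openCell hn hK hα1) (by positivity)
      (hae (Zorich.isOpen_openCell hn).measurableSet hsub)
  · exact isQuasiregularOn_of_lipschitzOnWith (Zorich.isOpen_openCell' hn)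
      (Zorich.isConnected_openCell' hn)
      (Zorich.lipschitzOnWith_zorichTransform_openCell' hn hK hα1) (by positivity)
      (hae (Zorich.isOpen_openCell' hn).measurableSet hsub')
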